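/- Let $p_1<p_2<\dots$ be primes with $p_i>3$ and $p_i\equiv 3 \pmod 4$ such that the numbers $\frac{p_i-1}{2}$ are pairwise coprime, and let $(n_i)$ be a sequence of non-negative integers with $n_i\to\infty$ and $$p_i^{n_i}-1\le 2^{(p_i-1)/2}\qquad\text{for all } i.$$ For a prime $p$ let $C_p$ be the cyclic group of order $p$, let $\mathrm{Aut}(C_p)^\circ\le \mathrm{Aut}(C_p)$ be the subgroup of automorphisms of odd order, and let $C_p^{n}\rtimes \mathrm{Aut}(C_p)^\circ$ be the semidirect product for the diagonal action. Let $$G=\prod_{i=1}^\infty \bigl(C_{p_i}^{n_i}\rtimes \mathrm{Aut}(C_{p_i})^\circ\bigr),$$ a profinite group with the product topology. Then $G$ is metabelian and has UBERG: there is a constant $c>0$ such that, for every finite field $F$ and every $n$, the number of isomorphism classes of $n$-dimensional irreducible continuous representations of $G$ over $F$ is at most $|F|^{cn}$. Moreover, $G$ is not (topologically) finitely generated, does not have type $\mathrm{FP}_1$ and does not have type $\mathrm{PFP}_1$. Here $G$ has type $\mathrm{FP}_1$ (respectively $\mathrm{PFP}_1$) if the trivial module $\hat{\mathbb Z}$ over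 the completed group algebra $\hat{\mathbb Z}[[G]]$ has a resolution $\cdots\to P_1\to P_0\to\hat{\mathbb Z}\to 0$ by projective profinite $\hat{\mathbb Z}[[G]]$-modules in which $P_0$ and $P_1$ are finitely generated (respectively positively finitely generated, meaning that for some $k\ge1$ a $k$-tuple of Haar-random elements generates the module topologically with positive probability). -/

import Mathlib

/-! ### The groups `C_p ^ n ⋊ Aut(C_p)°` -/

/-- The cyclic group of order `p`, written multiplicatively. -/
abbrev Cyc (p : ℕ) : Type := Multiplicative (ZMod p)

theorem Cyc.mulAut_commute (p : ℕ) (a b : MulAut (Cyc p)) : Commute a b := by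
  obtain ⟨k, hk⟩ := MonoidHom.map_cyclic (a : Cyc p →* Cyc p)
  obtain ⟨l, hl⟩ := MonoidHom.map_cyclic (b : Cyc p →* Cyc p)
  have hk' : ∀ g, a g = g ^ k := hk
  have hl' : ∀ g, b g = g ^ l := hl
  ext1 g
  simp only [MulAut.mul_apply, hk', hl', ← zpow_mul, mul_comm]

/-- `Aut(C_p)°`: the subgroup of all automorphisms of `C_p` of odd (finite) order. -/
def oddAut (p : ℕ) : Subgroup (MulAut (Cyc p)) where
  carrier := {a | Odd (orderOf a)}
  one_mem' := by simp
  mul_mem' := by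
    intro a b ha hb
    exact Odd.of_dvd_nat (ha.mul hb) (Cyc.mulAut_commute p a b).orderOf_mul_dvd_mul_orderOf
  inv_mem' := by
    intro a ha
    simpa using ha

/-- The diagonal action of `Aut(C_p)°` on `C_p ^ n`. -/
def diagAction (p n : ℕ) : oddAut p →* MulAut (Fin n → Cyc p) where
  toFun a := MulEquiv.piCongrRight fun _ => (a : MulAut (Cyc p))
  map_one' := rfl
  map_mul' _ _ := rfl

/-- The finite group `C_p ^ n ⋊ Aut(C_p)°`. -/
def GStar (p n : ℕ) : Type := (Fin n → Cyc p) ⋊[diagAction p n] oddAut p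

instance (p n : ℕ) : Group (GStar p n) :=
  inferInstanceAs (Group ((Fin n → Cyc p) ⋊[diagAction p n] oddAut p))

/-- Finite groups carry the discrete topology. -/
instance (p n : ℕ) : TopologicalSpace (GStar p n) := ⊥

instance (p n : ℕ) : DiscreteTopology (GStar p n) := ⟨rfl⟩

/-! ### Finite generation and UBERG for profinite groups -/

/-- A topological group is (topologically) finitely generated if some finite subset generates a
dense subgroup. -/
def TopFG (G : Type) [Group G] [TopologicalSpace G] : Prop :=
  ∃ S : Finset G, Dense (Subgroup.closure (S : Set G) : Set G)

/-- The continuous irreducible representations of `G` on `F ^ n`, where `F` is discrete. -/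
def IrrRep (G : Type) [Group G] [TopologicalSpace G] (F : Type) [Field F] (n : ℕ) : Type :=
  {ρ : Representation F G (Fin n → F) //
    @Continuous G (Module.End F (Fin n → F)) _ ⊥ ρ ∧ ρ.IsIrreducible}

/-- Isomorphism of irreducible representations. -/
instance IrrRep.setoid (G : Type) [Group G] [TopologicalSpace G] (F : Type) [Field F] (n : ℕ) :
    Setoid (IrrRep G F n) where
  r ρ σ := Nonempty (ρ.1.Equiv σ.1)
  iseqv := ⟨fun _ => ⟨.refl _⟩, fun ⟨e⟩ => ⟨e.symm⟩, fun ⟨e⟩ ⟨f⟩ => ⟨e.trans f⟩⟩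

/-- Uniformly bounded exponential representation growth: there is `c > 0` such that for every
finite field `F` and every `n` the number `r(G, F, n)` of isomorphism classes of irreducible
`n`-dimensional representations of `G` over `F` is (finite and) at most `|F| ^ (c n)`. -/
def UBERG (G : Type) [Group G] [TopologicalSpace G] : Prop :=
  ∃ c : ℝ, 0 < c ∧ ∀ (F : Type) [Field F] [Finite F] (n : ℕ),
    Finite (Quotient (IrrRep.setoid G F n)) ∧
      (Nat.card (Quotient (IrrRep.setoid G F n)) : ℝ) ≤ (Nat.card F : ℝ) ^ (c * n)

/-! ### Profinite modules over a topological ring, types `FP_n` and `PFP_n` -/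

/-- A profinite (left) `R`-module: a compact, Hausdorff, totally disconnected topological
`R`-module. -/
structure ProfMod (R : Type) [Ring R] [TopologicalSpace R] where
  carrier : Type
  [addCommGroup : AddCommGroup carrier]
  [module : Module R carrier]
  [topology : TopologicalSpace carrier]
  [isTopologicalAddGroup : IsTopologicalAddGroup carrier]
  [continuousSMul : ContinuousSMul R carrier]
  [compactSpace : CompactSpace carrier]
  [t2Space : T2Space carrier]
  [totallyDisconnectedSpace : TotallyDisconnectedSpace carrier]

attribute [instance] ProfMod.addCommGroup ProfMod.module ProfMod.topology
  ProfMod.isTopologicalAddGroup ProfMod.continuousSMul ProfMod.compactSpace ProfMod.t2Space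
  ProfMod.totallyDisconnectedSpace

instance (R : Type) [Ring R] [TopologicalSpace R] : CoeSort (ProfMod R) Type :=
  ⟨ProfMod.carrier⟩

namespace ProfMod

variable {R : Type} [Ring R] [TopologicalSpace R]

/-- The tuple `x` generates `M` topologically. -/
def Generates (M : ProfMod R) {k : ℕ} (x : Fin k → M) : Prop :=
  Dense (Submodule.span R (Set.range x) : Set M)

/-- `M` is (topologically) finitely generated. -/
def IsFG (M : ProfMod R) : Prop :=
  ∃ (k : ℕ) (x : Fin k → M), M.Generates x

/-- The normalised Haar measure on `M ^ k`, i.e. the law of `k` independent Haar-random elements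
of `M`. -/
noncomputable def haarPow (M : ProfMod R) (k : ℕ) :
    @MeasureTheory.Measure (Fin k → M) (borel _) :=
  letI : MeasurableSpace (Fin k → M) := borel _
  haveI : BorelSpace (Fin k → M) := ⟨rfl⟩
  MeasureTheory.Measure.addHaarMeasure ⊤

/-- `M` is positively finitely generated: for some `k ≥ 1`, with positive probability `k`
Haar-random elements generate `M`. -/
def IsPFG (M : ProfMod R) : Prop :=
  ∃ k : ℕ, 0 < k ∧ 0 < M.haarPow k {x | M.Generates x}

/-- `P` is projective in the category of profinite `R`-modules and continuous homomorphisms. -/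
def IsProjective (P : ProfMod R) : Prop :=
  ∀ (A B : ProfMod R) (f : A →L[R] B) (g : P →L[R] B), Function.Surjective f →
    ∃ h : P →L[R] A, f.comp h = g

/-- A projective resolution `⋯ → P 2 → P 1 → P 0 → M → 0` of the profinite module `M`. -/
structure ProjRes (M : ProfMod R) where
  P : ℕ → ProfMod R
  projective : ∀ i, (P i).IsProjective
  d : ∀ i, P (i + 1) →L[R] P i
  ε : P 0 →L[R] M
  surjective : Function.Surjective ε
  exact_zero : Function.Exact (d 0) ε
  exact_succ : ∀ i, Function.Exact (d (i + 1)) (d i)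

/-- `M` has type `FP_n`: it has a projective resolution with `P_0, …, P_n` finitely generated. -/
def TypeFP (M : ProfMod R) (n : ℕ) : Prop :=
  ∃ Q : ProjRes M, ∀ i ≤ n, (Q.P i).IsFG

/-- `M` has type `PFP_n`: it has a projective resolution with `P_0, …, P_n` positively finitely
generated. -/
def TypePFP (M : ProfMod R) (n : ℕ) : Prop :=
  ∃ Q : ProjRes M, ∀ i ≤ n, (Q.P i).IsPFG

end ProfMod

/-! ### The profinite integers and the completed group algebra -/

/-- The profinite integers `Ẑ = lim ℤ/n`, as a topological ring. -/
def ZHat : Subring (∀ n : ℕ+, ZMod n) where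
  carrier := {x | ∀ (m n : ℕ+) (h : (m : ℕ) ∣ n), ZMod.castHom h (ZMod m) (x n) = x m}
  mul_mem' hx hy m n h := by simp only [Pi.mul_apply, map_mul, hx m n h, hy m n h]
  one_mem' m n h := by simp only [Pi.one_apply, map_one]
  add_mem' hx hy m n h := by simp only [Pi.add_apply, map_add, hx m n h, hy m n h]
  zero_mem' m n h := by simp only [Pi.zero_apply, map_zero]
  neg_mem' hx m n h := by simp only [Pi.neg_apply, map_neg, hx m n h]

theorem ZHat.isClosed : IsClosed (ZHat : Set (∀ n : ℕ+, ZMod n)) := by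
  have : (ZHat : Set (∀ n : ℕ+, ZMod n)) =
      ⋂ (m : ℕ+) (n : ℕ+) (h : (m : ℕ) ∣ n), {x | ZMod.castHom h (ZMod m) (x n) = x m} := by
    ext x
    simp only [Set.mem_iInter]
    rfl
  rw [this]
  refine isClosed_iInter fun m => isClosed_iInter fun n => isClosed_iInter fun h => ?_
  exact isClosed_eq (continuous_of_discreteTopology.comp (continuous_apply n))
    (continuous_apply m)

instance : CompactSpace ZHat :=
  isCompact_iff_compactSpace.mp ZHat.isClosed.isCompact

section CompletedGroupAlgebra

variable (G : Type) [Group G] [TopologicalSpace G]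

/-- The finite group ring `(ℤ/n)[G/U]`, with the discrete topology, for `n ≥ 1` and `U` an open
normal subgroup of `G`. -/
def GroupRingLevel (i : ℕ+ × OpenNormalSubgroup G) : Type :=
  MonoidAlgebra (ZMod i.1) (G ⧸ i.2.toSubgroup)

noncomputable instance (i : ℕ+ × OpenNormalSubgroup G) : Ring (GroupRingLevel G i) :=
  inferInstanceAs (Ring (MonoidAlgebra (ZMod i.1) (G ⧸ i.2.toSubgroup)))

instance (i : ℕ+ × OpenNormalSubgroup G) : TopologicalSpace (GroupRingLevel G i) := ⊥

instance (i : ℕ+ × OpenNormalSubgroup G) : DiscreteTopology (GroupRingLevel G i) := ⟨rfl⟩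

variable {G}

/-- The transition map `(ℤ/n)[G/U] → (ℤ/m)[G/V]` for `m ∣ n` and `U ≤ V`. -/
noncomputable def GroupRingLevel.trans {i j : ℕ+ × OpenNormalSubgroup G}
    (h : (j.1 : ℕ) ∣ i.1) (h' : i.2.toSubgroup ≤ j.2.toSubgroup) :
    GroupRingLevel G i →+* GroupRingLevel G j :=
  (MonoidAlgebra.mapRingHom (G ⧸ j.2.toSubgroup) (ZMod.castHom h (ZMod j.1))).comp
    (MonoidAlgebra.mapDomainRingHom (ZMod i.1)
      (QuotientGroup.map i.2.toSubgroup j.2.toSubgroup (MonoidHom.id G) h'))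

/-- The augmentation `(ℤ/n)[G/U] → ℤ/n`, sending every group element to `1`. -/
noncomputable def GroupRingLevel.aug (i : ℕ+ × OpenNormalSubgroup G) :
    GroupRingLevel G i →+* ZMod i.1 :=
  (MonoidAlgebra.lift (ZMod i.1) (ZMod i.1) (G ⧸ i.2.toSubgroup) 1).toRingHom

theorem MonoidAlgebra.lift_one_mapRingHom_mapDomain {m n : ℕ} (h : m ∣ n) {Q Q' : Type} [Group Q]
    [Group Q'] (f : Q →* Q') (x : MonoidAlgebra (ZMod n) Q) :
    MonoidAlgebra.lift (ZMod m) (ZMod m) Q' 1 (MonoidAlgebra.mapRingHom Q' (ZMod.castHom h (ZMod m))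
      (MonoidAlgebra.mapDomainRingHom (ZMod n) f x)) =
    ZMod.castHom h (ZMod m) (MonoidAlgebra.lift (ZMod n) (ZMod n) Q 1 x) := by
  suffices H : ((MonoidAlgebra.lift (ZMod m) (ZMod m) Q' 1).toRingHom.comp
      ((MonoidAlgebra.mapRingHom Q' (ZMod.castHom h (ZMod m))).comp
        (MonoidAlgebra.mapDomainRingHom (ZMod n) f))) =
      (ZMod.castHom h (ZMod m)).comp (MonoidAlgebra.lift (ZMod n) (ZMod n) Q 1).toRingHom from
    congrArg (fun f => f x) H
  refine MonoidAlgebra.ringHom_ext ?_ ?_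
  · intro r
    simp
  · intro g
    simp

theorem GroupRingLevel.aug_trans {i j : ℕ+ × OpenNormalSubgroup G}
    (h : (j.1 : ℕ) ∣ i.1) (h' : i.2.toSubgroup ≤ j.2.toSubgroup) (x : GroupRingLevel G i) :
    aug j (trans h h' x) = ZMod.castHom h (ZMod j.1) (aug i x) :=
  MonoidAlgebra.lift_one_mapRingHom_mapDomain h _ x

variable (G)

/-- The completed group algebra `Ẑ⟦G⟧ = lim (ℤ/n)[G/U]`, as a topological ring. -/
noncomputable def CompletedGroupAlgebra : Subring (∀ i, GroupRingLevel G i) where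
  carrier := {x | ∀ (i j : ℕ+ × OpenNormalSubgroup G) (h : (j.1 : ℕ) ∣ i.1)
    (h' : i.2.toSubgroup ≤ j.2.toSubgroup), GroupRingLevel.trans h h' (x i) = x j}
  mul_mem' hx hy i j h h' := by simp only [Pi.mul_apply, map_mul, hx i j h h', hy i j h h']
  one_mem' i j h h' := by simp only [Pi.one_apply, map_one]
  add_mem' hx hy i j h h' := by simp only [Pi.add_apply, map_add, hx i j h h', hy i j h h']
  zero_mem' i j h h' := by simp only [Pi.zero_apply, map_zero]
  neg_mem' hx i j h h' := by simp only [Pi.neg_apply, map_neg, hx i j h h']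

/-- The whole group as an open normal subgroup. -/
def wholeGroup : OpenNormalSubgroup G where
  toSubgroup := ⊤
  isOpen' := isOpen_univ
  isNormal' := inferInstance

/-- The augmentation homomorphism `Ẑ⟦G⟧ → Ẑ`. (By compatibility it can be read off at any open
normal subgroup; here `G` itself is used.) -/
noncomputable def augmentation : CompletedGroupAlgebra G →+* ZHat where
  toFun x := ⟨fun n => GroupRingLevel.aug (n, wholeGroup G) (x.1 (n, wholeGroup G)),
    fun m n h => by
      have hx := x.2 (n, wholeGroup G) (m, wholeGroup G) h le_rfl
      exact (GroupRingLevel.aug_trans (i := (n, wholeGroup G)) (j := (m, wholeGroup G))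
        h le_rfl _).symm.trans (congrArg _ hx)⟩
  map_one' := Subtype.ext (funext fun _ => map_one _)
  map_mul' _ _ := Subtype.ext (funext fun _ => map_mul _ _ _)
  map_zero' := Subtype.ext (funext fun _ => map_zero _)
  map_add' _ _ := Subtype.ext (funext fun _ => map_add _ _ _)

theorem continuous_augmentation : Continuous (augmentation G) := by
  refine Continuous.subtype_mk (continuous_pi fun n => ?_) _
  exact continuous_of_discreteTopology.comp
    ((continuous_apply (n, wholeGroup G)).comp continuous_subtype_val)

/-- The underlying additive group of `Ẑ`, as a carrier of the trivial `Ẑ⟦G⟧`-module. -/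
@[nolint unusedArguments]
def TrivZHat (G : Type) [Group G] [TopologicalSpace G] : Type := ZHat

noncomputable instance : AddCommGroup (TrivZHat G) := inferInstanceAs (AddCommGroup ZHat)
instance : TopologicalSpace (TrivZHat G) := inferInstanceAs (TopologicalSpace ZHat)
instance : IsTopologicalAddGroup (TrivZHat G) := inferInstanceAs (IsTopologicalAddGroup ZHat)
instance : CompactSpace (TrivZHat G) := inferInstanceAs (CompactSpace ZHat)
instance : T2Space (TrivZHat G) := inferInstanceAs (T2Space ZHat)
instance : TotallyDisconnectedSpace (TrivZHat G) :=
  inferInstanceAs (TotallyDisconnectedSpace ZHat)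
noncomputable instance : Module (CompletedGroupAlgebra G) (TrivZHat G) :=
  Module.compHom ZHat (augmentation G)
instance : ContinuousSMul (CompletedGroupAlgebra G) (TrivZHat G) :=
  ⟨((continuous_augmentation G).comp continuous_fst).mul
    (continuous_snd : Continuous fun p : CompletedGroupAlgebra G × ZHat => p.2)⟩

/-- `Ẑ` as a profinite `Ẑ⟦G⟧`-module, `Ẑ⟦G⟧` acting through the augmentation (so `G` acts
trivially). -/
noncomputable def trivialModule : ProfMod (CompletedGroupAlgebra G) where
  carrier := TrivZHat G

/-- The profinite group `G` has type `FP_n` (over `Ẑ`). -/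
def GroupTypeFP (n : ℕ) : Prop := (trivialModule G).TypeFP n

/-- The profinite group `G` has type `PFP_n` (over `Ẑ`). -/
def GroupTypePFP (n : ℕ) : Prop := (trivialModule G).TypePFP n

end CompletedGroupAlgebra

/-! In $C_p^n\rtimes\mathrm{Aut}(C_p)^\circ$ the complement acts on $\mathbb F_p^n$ by scalars.
Every subspace is therefore stable, and $n$ generators are needed to produce all of $\mathbb F_p^n$.
As $n_i\to\infty$, this rules out topological finite generation (`not_topFG_pi_gstar`). The same
obstruction survives linearly: $\mathbb F_p^n$ is a quotient of the augmentation ideal on which the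
group ring acts by scalars, so type $\mathrm{FP}_1$ would bound all $n_i$
(`GroupTypeFP.exists_rank_le`). A set of positive measure is nonempty, so $\mathrm{PFP}_1$ fails
too. The group is metabelian because $\mathrm{Aut}(C_p)$ is abelian.

For UBERG, extend an irreducible $\rho$ of dimension $m$ over $F$ to the algebraic closure $K$ and
choose a common eigenvector $v$ of $\prod C_{p_i}^{n_i}$, with character $\chi$. A nontrivial
component of $\chi$ has trivial stabiliser in $\mathrm{Aut}(C_{p_i})^\circ$, so the translates of
$v$ have distinct weights and $\prod (p_i-1)/2\le m$ over the support of $\chi$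
(`IsWeightVector.prod_le`). Hence $\sum (p_i-1)/2\le m$ there, and $p_i^{n_i}-1\le 2^{(p_i-1)/2}$
leaves at most $2^m$ characters for each support.

The complement away from the support preserves the $\chi$-weight space. Being a product of cyclic
groups of coprime orders, it is generated, up to a tail acting trivially, by one element, so $v$ may
be taken to be an eigenvector of it, with eigenvalue $\lambda$. The pair $(\chi,\lambda)$ determines
the action of $G$ on $v$ up to naming independent vectors, hence determines $\rho$
(`IsWeightVector.apply_eq`, `Representation.nonempty_equiv_of_monomial`). Since $\lambda$ is a root
of a monic polynomial of degree $m$ over $F$, counting pairs finishes the proof. -/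

open Multiplicative

/-! ### The affine structure of `C_p ^ n ⋊ Aut(C_p)°` -/

/-- The scalar by which an automorphism of `C_p` acts. -/
def Cyc.scal (p : ℕ) : MulAut (Cyc p) →* ZMod p where
  toFun a := toAdd (a (ofAdd 1))
  map_one' := rfl
  map_mul' a b := by
    obtain ⟨k, hk⟩ := MonoidHom.map_cyclic (a : Cyc p →* Cyc p)
    have hk' : ∀ g, a g = g ^ k := hk
    simp [MulAut.mul_apply, hk']

theorem Cyc.toAdd_mulAut_apply {p : ℕ} (a : MulAut (Cyc p)) (x : Cyc p) :
    toAdd (a x) = Cyc.scal p a * toAdd x := by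
  obtain ⟨k, hk⟩ := MonoidHom.map_cyclic (a : Cyc p →* Cyc p)
  have hk' : ∀ g, a g = g ^ k := hk
  change toAdd (a x) = toAdd (a (ofAdd 1)) * toAdd x
  simp [hk']

theorem Cyc.scal_injective (p : ℕ) : Function.Injective (Cyc.scal p) := by
  intro a b h
  ext1 x
  apply toAdd.injective
  rw [Cyc.toAdd_mulAut_apply, Cyc.toAdd_mulAut_apply, h]

namespace GStar

variable {p n : ℕ}

/-- The inclusion of `C_p ^ n`. -/
def inl : (Fin n → Cyc p) →* GStar p n := SemidirectProduct.inl

/-- The inclusion of `Aut(C_p)°`. -/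
def inr : oddAut p →* GStar p n := SemidirectProduct.inr

/-- The projection onto `Aut(C_p)°`. -/
def right : GStar p n →* oddAut p := SemidirectProduct.rightHom

/-- The component in `C_p ^ n`. -/
def left (g : GStar p n) : Fin n → Cyc p := SemidirectProduct.left g

theorem ext {g h : GStar p n} (h1 : g.left = h.left) (h2 : right g = right h) : g = h :=
  SemidirectProduct.ext h1 h2

theorem left_mul (g h : GStar p n) :
    (g * h).left = g.left * diagAction p n (right g) h.left := rfl

@[simp] theorem left_inl (x : Fin n → Cyc p) : (inl x : GStar p n).left = x := rfl

@[simp] theorem left_inr (a : oddAut p) : (inr a : GStar p n).left = 1 := rfl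

@[simp] theorem right_inl (x : Fin n → Cyc p) : right (inl x : GStar p n) = 1 := rfl

@[simp] theorem right_inr (a : oddAut p) : right (inr a : GStar p n) = a := rfl

theorem inl_left_mul_inr_right (g : GStar p n) : inl g.left * inr (right g) = g :=
  SemidirectProduct.inl_left_mul_inr_right g

theorem inr_mul_inl (a : oddAut p) (x : Fin n → Cyc p) :
    (inr a : GStar p n) * inl x = inl (diagAction p n a x) * inr a := by
  refine GStar.ext ?_ ?_
  · simp [left_mul]
  · simp

theorem toAdd_diagAction (a : oddAut p) (x : Fin n → Cyc p) (j : Fin n) :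
    toAdd (diagAction p n a x j) = Cyc.scal p a * toAdd (x j) :=
  Cyc.toAdd_mulAut_apply _ _

/-- The component in `C_p ^ n`, as a vector over `ZMod p`. -/
def vec (g : GStar p n) : Fin n → ZMod p := fun j => toAdd (g.left j)

theorem vec_mul (g h : GStar p n) :
    (g * h).vec = g.vec + Cyc.scal p (right g) • h.vec := by
  funext j
  simp only [vec, left_mul, Pi.mul_apply, toAdd_mul, toAdd_diagAction, Pi.add_apply, Pi.smul_apply,
    smul_eq_mul]

@[simp] theorem vec_one : (1 : GStar p n).vec = 0 := rfl

theorem exists_vec_eq (v : Fin n → ZMod p) : ∃ x, (inl x : GStar p n).vec = v :=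
  ⟨fun j => ofAdd (v j), rfl⟩

/-- The elements of `C_p ^ n ⋊ Aut(C_p)°` whose vector component lies in a given subspace. -/
def vecSubgroup (U : Submodule (ZMod p) (Fin n → ZMod p)) : Subgroup (GStar p n) where
  carrier := {g | g.vec ∈ U}
  one_mem' := by simp
  mul_mem' {g h} hg hh := by
    simp only [Set.mem_ofPred_eq, vec_mul] at *
    exact U.add_mem hg (U.smul_mem _ hh)
  inv_mem' {g} hg := by
    have h := vec_mul g⁻¹ g
    rw [inv_mul_cancel, vec_one] at h
    rw [Set.mem_ofPred_eq, eq_neg_of_add_eq_zero_left h.symm]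
    exact U.neg_mem (U.smul_mem _ hg)

end GStar

/-! ### Solvability and failure of finite generation -/

theorem derivedSeries_pi_gstar (p n : ℕ → ℕ) :
    derivedSeries (∀ i, GStar (p i) (n i)) 2 = ⊥ := by
  let f : (∀ i, GStar (p i) (n i)) →* ∀ i, oddAut (p i) :=
    MonoidHom.pi fun i => GStar.right.comp (Pi.evalMonoidHom _ i)
  have h1 : derivedSeries (∀ i, GStar (p i) (n i)) 1 ≤ f.ker := by
    rw [derivedSeries_succ, derivedSeries_zero, Subgroup.commutator_le]
    intro g _ h _
    rw [MonoidHom.mem_ker, map_commutatorElement, commutatorElement_eq_one_iff_commute]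
    funext i
    exact Subtype.ext (Cyc.mulAut_commute _ _ _)
  rw [derivedSeries_succ, eq_bot_iff, Subgroup.commutator_le]
  intro g hg h hh
  have hg' := fun i => congrFun (h1 hg) i
  have hh' := fun i => congrFun (h1 hh) i
  rw [Subgroup.mem_bot, commutatorElement_eq_one_iff_commute]
  funext i
  have e1 : GStar.right (g i) = 1 := hg' i
  have e2 : GStar.right (h i) = 1 := hh' i
  refine GStar.ext ?_ ?_
  · change (g i * h i).left = (h i * g i).left
    rw [GStar.left_mul, GStar.left_mul, e1, e2, map_one]
    exact mul_comm _ _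
  · change GStar.right (g i * h i) = GStar.right (h i * g i)
    rw [map_mul, map_mul, e1, e2]

theorem not_topFG_pi_gstar (p n : ℕ → ℕ) (hp : ∀ i, (p i).Prime)
    (hn : Filter.Tendsto n Filter.atTop Filter.atTop) :
    ¬ TopFG (∀ i, GStar (p i) (n i)) := by
  rintro ⟨S, hS⟩
  obtain ⟨i, hi⟩ := (hn.eventually_gt_atTop S.card).exists
  have := Fact.mk (hp i)
  -- Fewer than `n i` vectors span `U`, yet the closed subgroup it defines contains the dense
  -- closure of `S`.
  let U : Submodule (ZMod (p i)) (Fin (n i) → ZMod (p i)) :=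
    Submodule.span _ (Set.range fun s : S => (s.1 i).vec)
  let T : Subgroup (∀ i, GStar (p i) (n i)) :=
    (GStar.vecSubgroup U).comap (Pi.evalMonoidHom _ i)
  have hST : Subgroup.closure (S : Set (∀ i, GStar (p i) (n i))) ≤ T := by
    rw [Subgroup.closure_le]
    intro s hs
    exact Submodule.subset_span ⟨⟨s, hs⟩, rfl⟩
  have hclosed : IsClosed (T : Set (∀ i, GStar (p i) (n i))) :=
    (isClosed_discrete (GStar.vecSubgroup U : Set (GStar (p i) (n i)))).preimage
      (continuous_apply (A := fun i => GStar (p i) (n i)) i)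
  have hT : ∀ g, g ∈ T := fun g => hclosed.closure_subset_iff.2 hST (hS g)
  have hU : U = ⊤ := by
    rw [eq_top_iff]
    intro v _
    obtain ⟨x, hx⟩ := GStar.exists_vec_eq v
    have h : (GStar.inl x : GStar (p i) (n i)).vec ∈ U := by
      have h := hT (Pi.mulSingle i (GStar.inl x))
      have h : (Pi.mulSingle (M := fun i => GStar (p i) (n i)) i (GStar.inl x) i).vec ∈ U := h
      rwa [Pi.mulSingle_eq_same] at h
    rwa [hx] at h
  have h1 : Module.finrank (ZMod (p i)) U ≤ S.card := by
    exact (finrank_range_le_card (R := ZMod (p i)) fun s : S => (s.1 i).vec).trans_eq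
      (Fintype.card_coe S)
  rw [hU, finrank_top, Module.finrank_fin_fun] at h1
  omega

/-! ### The completed group algebra as a profinite module, and type `FP₁` -/

section CompletedGroupAlgebraLemmas

variable (G : Type) [Group G] [TopologicalSpace G]

theorem CompletedGroupAlgebra.isClosed :
    IsClosed (CompletedGroupAlgebra G : Set (∀ i, GroupRingLevel G i)) := by
  have : (CompletedGroupAlgebra G : Set (∀ i, GroupRingLevel G i)) =
      ⋂ (i : ℕ+ × OpenNormalSubgroup G) (j : ℕ+ × OpenNormalSubgroup G) (h : (j.1 : ℕ) ∣ i.1)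
        (h' : i.2.toSubgroup ≤ j.2.toSubgroup), {x | GroupRingLevel.trans h h' (x i) = x j} := by
    ext x
    simp only [Set.mem_iInter]
    rfl
  rw [this]
  refine isClosed_iInter fun i => isClosed_iInter fun j => isClosed_iInter fun h =>
    isClosed_iInter fun h' => ?_
  exact isClosed_eq (continuous_of_discreteTopology.comp (continuous_apply i)) (continuous_apply j)

theorem GroupRingLevel.finite [SeparatelyContinuousMul G] [CompactSpace G]
    (i : ℕ+ × OpenNormalSubgroup G) : Finite (GroupRingLevel G i) := by
  have : Finite (G ⧸ i.2.toSubgroup) := i.2.toSubgroup.quotient_finite_of_isOpen i.2.isOpen'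
  have : NeZero (i.1 : ℕ) := ⟨i.1.ne_zero⟩
  have : Finite (ZMod i.1) := inferInstance
  have h : Finite ((G ⧸ i.2.toSubgroup) →₀ ZMod i.1) :=
    Finite.of_injective _ (DFunLike.coe_injective (F := (G ⧸ i.2.toSubgroup) →₀ ZMod i.1))
  exact Finite.of_equiv _ (MonoidAlgebra.coeffEquiv (R := ZMod i.1) (M := G ⧸ i.2.toSubgroup)).symm

theorem CompletedGroupAlgebra.compactSpace [SeparatelyContinuousMul G] [CompactSpace G] :
    CompactSpace (CompletedGroupAlgebra G) :=
  have := fun i => GroupRingLevel.finite G i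
  isCompact_iff_compactSpace.mp (CompletedGroupAlgebra.isClosed G).isCompact

/-- The completed group algebra of a compact group, as a profinite module over itself. -/
noncomputable def regularModule [SeparatelyContinuousMul G] [CompactSpace G] :
    ProfMod (CompletedGroupAlgebra G) :=
  have := CompletedGroupAlgebra.compactSpace G
  { carrier := CompletedGroupAlgebra G }

/-- The augmentation as a homomorphism of profinite modules. -/
noncomputable def augmentationL [SeparatelyContinuousMul G] [CompactSpace G] :
    regularModule G →L[CompletedGroupAlgebra G] trivialModule G where
  toFun x := augmentation G x
  map_add' x y := map_add (augmentation G) x y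
  map_smul' r x := map_mul (augmentation G) r x
  cont := continuous_augmentation G

variable {G}

/-- The image of a group element in the completed group algebra. -/
noncomputable def CompletedGroupAlgebra.of (g : G) : CompletedGroupAlgebra G :=
  ⟨fun i => MonoidAlgebra.of (ZMod i.1) (G ⧸ i.2.toSubgroup) (g : G ⧸ i.2.toSubgroup), by
    intro i j h h'
    change MonoidAlgebra.mapRingHom _ _ (MonoidAlgebra.mapDomainRingHom _ _
      (MonoidAlgebra.of (ZMod i.1) (G ⧸ i.2.toSubgroup) (g : G ⧸ i.2.toSubgroup))) =
        MonoidAlgebra.of (ZMod j.1) (G ⧸ j.2.toSubgroup) (g : G ⧸ j.2.toSubgroup)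
    simp [-ZMod.castHom_apply]
    rfl⟩

theorem augmentation_of (g : G) : augmentation G (CompletedGroupAlgebra.of g) = 1 := by
  refine Subtype.ext (funext fun n => ?_)
  change MonoidAlgebra.lift (ZMod n) (ZMod n) (G ⧸ (wholeGroup G).toSubgroup) 1
    (MonoidAlgebra.of (ZMod n) _ _) = 1
  simp

theorem augmentation_surjective : Function.Surjective (augmentation G) := by
  intro z
  refine ⟨⟨fun i => algebraMap (ZMod i.1) (MonoidAlgebra (ZMod i.1) (G ⧸ i.2.toSubgroup))
    (z.1 i.1), ?_⟩, ?_⟩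
  · intro i j h h'
    change MonoidAlgebra.mapRingHom _ _ (MonoidAlgebra.mapDomainRingHom _ _
      (algebraMap (ZMod i.1) (MonoidAlgebra (ZMod i.1) (G ⧸ i.2.toSubgroup)) (z.1 i.1))) =
      algebraMap (ZMod j.1) (MonoidAlgebra (ZMod j.1) (G ⧸ j.2.toSubgroup)) (z.1 j.1)
    rw [← z.2 j.1 i.1 h]
    simp [MonoidAlgebra.coe_algebraMap]
  · refine Subtype.ext (funext fun n => ?_)
    change MonoidAlgebra.lift (ZMod n) (ZMod n) (G ⧸ (wholeGroup G).toSubgroup) 1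
      (algebraMap _ _ (z.1 n)) = z.1 n
    rw [AlgHom.commutes]
    rfl

/-- Transition maps preserve augmentations. This is needed because the affine action is read at the
level of a kernel `U`, not at the whole group. -/
theorem aug_eq_augmentation_apply (r : CompletedGroupAlgebra G) (m : ℕ+)
    (U : OpenNormalSubgroup G) :
    GroupRingLevel.aug (m, U) (r.1 (m, U)) = (augmentation G r).1 m := by
  have h := GroupRingLevel.aug_trans (i := (m, U)) (j := (m, wholeGroup G)) dvd_rfl le_top
    (r.1 (m, U))
  rw [r.2 (m, U) (m, wholeGroup G) dvd_rfl le_top] at h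
  rw [ZMod.castHom_self] at h
  exact h.symm

end CompletedGroupAlgebraLemmas

/-- The affine representation of `C_p ^ n ⋊ Aut(C_p)°`. -/
def GStar.affine (p n : ℕ) :
    GStar p n →* Module.End (ZMod p) ((Fin n → ZMod p) × ZMod p) where
  toFun g :=
    { toFun := fun w => (Cyc.scal p (GStar.right g) • w.1 + w.2 • g.vec, w.2)
      map_add' := fun v w => Prod.ext (by simp only [Prod.fst_add, Prod.snd_add]; module) rfl
      map_smul' := fun c w => Prod.ext (by
        simp only [Prod.smul_fst, Prod.smul_snd, RingHom.id_apply, smul_eq_mul]; module) rfl }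
  map_one' := by ext <;> simp
  map_mul' g h := LinearMap.ext fun w => Prod.ext (by
    simp only [map_mul, Subgroup.coe_mul, GStar.vec_mul, LinearMap.coe_mk, AddHom.coe_mk,
      Module.End.mul_apply]
    module) rfl

/-! ### The affine action of the completed group algebra -/

section Level

variable {G : Type} [Group G] [TopologicalSpace G] {p n : ℕ} [hp : Fact p.Prime]

/-- The action of a level of the completed group algebra on the affine representation. -/
noncomputable def affineLevel (φ : G →* GStar p n) (U : OpenNormalSubgroup G)
    (hU : U.toSubgroup ≤ φ.ker) :
    GroupRingLevel G (⟨p, hp.out.pos⟩, U) →+*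
      Module.End (ZMod p) ((Fin n → ZMod p) × ZMod p) :=
  (MonoidAlgebra.lift (ZMod p) (Module.End (ZMod p) ((Fin n → ZMod p) × ZMod p))
    (G ⧸ U.toSubgroup) ((GStar.affine p n).comp (QuotientGroup.lift U.toSubgroup φ hU))).toRingHom

/-- The augmentation of a level modulo `p`. -/
noncomputable def augLevel (U : OpenNormalSubgroup G)
    (x : GroupRingLevel G (⟨p, hp.out.pos⟩, U)) : ZMod p :=
  GroupRingLevel.aug _ x

variable (p) in
/-- The augmentation modulo `p`. -/
noncomputable def augMod (r : CompletedGroupAlgebra G) : ZMod p :=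
  (augmentation G r).1 ⟨p, hp.out.pos⟩

theorem augMod_eq_zero {r : CompletedGroupAlgebra G} (h : augmentation G r = 0) :
    augMod p r = 0 :=
  congrArg (fun z : ZHat => z.1 ⟨p, hp.out.pos⟩) h

theorem augMod_eq_one {r : CompletedGroupAlgebra G} (h : augmentation G r = 1) :
    augMod p r = 1 :=
  congrArg (fun z : ZHat => z.1 ⟨p, hp.out.pos⟩) h

/-- Group elements act by block triangular matrices, scalar on `ZMod p ^ n` and trivial on the
quotient line. This shape is preserved by linear combinations, and the entry on the quotient line
becomes the augmentation. -/
theorem MonoidAlgebra.exists_lift_affine_eq {Q : Type} [Group Q] (ψ : Q →* GStar p n)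
    (x : MonoidAlgebra (ZMod p) Q) :
    ∃ (θ : ZMod p) (D : Fin n → ZMod p), ∀ w,
      MonoidAlgebra.lift (ZMod p) _ Q ((GStar.affine p n).comp ψ) x w =
      (θ • w.1 + w.2 • D, MonoidAlgebra.lift (ZMod p) (ZMod p) Q 1 x * w.2) := by
  induction x using MonoidAlgebra.induction_on with
  | of g =>
    refine ⟨Cyc.scal p (GStar.right (ψ g)), (ψ g).vec, fun w => ?_⟩
    simp only [MonoidAlgebra.lift_of, MonoidHom.comp_apply, MonoidHom.one_apply, one_mul]
    rfl
  | add x y hx hy =>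
    obtain ⟨θ, D, h⟩ := hx
    obtain ⟨θ', D', h'⟩ := hy
    refine ⟨θ + θ', D + D', fun w => ?_⟩
    rw [map_add, LinearMap.add_apply, h, h', map_add]
    refine Prod.ext ?_ (add_mul _ _ _).symm
    simp only [Prod.fst_add]
    module
  | smul r x hx =>
    obtain ⟨θ, D, h⟩ := hx
    refine ⟨r * θ, r • D, fun w => ?_⟩
    rw [map_smul, LinearMap.smul_apply, h, map_smul]
    refine Prod.ext ?_ (mul_assoc _ _ _).symm
    simp only [Prod.smul_fst]
    module

theorem exists_affineLevel_eq (φ : G →* GStar p n) (U : OpenNormalSubgroup G)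
    (hU : U.toSubgroup ≤ φ.ker) (x : GroupRingLevel G (⟨p, hp.out.pos⟩, U)) :
    ∃ (θ : ZMod p) (D : Fin n → ZMod p), ∀ w, affineLevel φ U hU x w =
      (θ • w.1 + w.2 • D, augLevel U x * w.2) :=
  MonoidAlgebra.exists_lift_affine_eq (QuotientGroup.lift U.toSubgroup φ hU) x

/-- The action of the completed group algebra on the affine representation. -/
noncomputable def affineAction (φ : G →* GStar p n) (U : OpenNormalSubgroup G)
    (hU : U.toSubgroup ≤ φ.ker) :
    CompletedGroupAlgebra G →+* Module.End (ZMod p) ((Fin n → ZMod p) × ZMod p) :=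
  (affineLevel φ U hU).comp ((Pi.evalRingHom _ _).comp (CompletedGroupAlgebra G).subtype)

theorem affineAction_of (φ : G →* GStar p n) (U : OpenNormalSubgroup G)
    (hU : U.toSubgroup ≤ φ.ker) (g : G) :
    affineAction φ U hU (CompletedGroupAlgebra.of g) = GStar.affine p n (φ g) := by
  change MonoidAlgebra.lift (ZMod p) (Module.End (ZMod p) ((Fin n → ZMod p) × ZMod p))
    (G ⧸ U.toSubgroup) ((GStar.affine p n).comp (QuotientGroup.lift U.toSubgroup φ hU))
    (MonoidAlgebra.of _ _ (g : G ⧸ U.toSubgroup)) = _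
  rw [MonoidAlgebra.lift_of]
  rfl

theorem exists_affineAction_eq (φ : G →* GStar p n) (U : OpenNormalSubgroup G)
    (hU : U.toSubgroup ≤ φ.ker) (r : CompletedGroupAlgebra G) :
    ∃ (θ : ZMod p) (D : Fin n → ZMod p), ∀ w, affineAction φ U hU r w =
      (θ • w.1 + w.2 • D, augMod p r * w.2) := by
  have h : augMod p r = augLevel U (r.1 (⟨p, hp.out.pos⟩, U)) :=
    (aug_eq_augmentation_apply r ⟨p, hp.out.pos⟩ U).symm
  rw [h]
  exact exists_affineLevel_eq φ U hU _

theorem continuous_affineAction_apply (φ : G →* GStar p n) (U : OpenNormalSubgroup G)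
    (hU : U.toSubgroup ≤ φ.ker) (w : (Fin n → ZMod p) × ZMod p) :
    Continuous fun r => affineAction φ U hU r w :=
  (continuous_of_discreteTopology (f := fun x => affineLevel φ U hU x w)).comp
    ((continuous_apply _).comp continuous_subtype_val)

end Level

/-- If `G` has type `FP₁`, then the ranks of its quotients `C_p ^ n ⋊ Aut(C_p)°` are bounded. -/
theorem GroupTypeFP.exists_rank_le {G : Type} [Group G] [TopologicalSpace G]
    [SeparatelyContinuousMul G] [CompactSpace G] (hG : GroupTypeFP G 1) :
    ∃ k : ℕ, ∀ (p n : ℕ) [Fact p.Prime] (φ : G →* GStar p n), Continuous φ →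
      Function.Surjective φ → n ≤ k := by
  obtain ⟨Q, hQ⟩ := hG
  obtain ⟨k, y, hy⟩ := hQ 1 le_rfl
  refine ⟨k, fun p n hp φ hφ hsurj => ?_⟩
  -- Projectivity of `P 0` compares the unknown resolution with the standard start given by the
  -- augmentation.
  obtain ⟨h, hh⟩ := Q.projective 0 (regularModule G) (trivialModule G) (augmentationL G) Q.ε
    augmentation_surjective
  have haug : ∀ x, augmentation G (h x) = Q.ε x := fun x => congrArg (fun f => f x) hh
  let U : OpenNormalSubgroup G :=
    { toSubgroup := φ.ker
      isOpen' := (isOpen_discrete ({1} : Set (GStar p n))).preimage hφ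
      isNormal' := inferInstance }
  let T := affineAction φ U le_rfl
  -- Boundaries have augmentation zero, so they send `(0, 1)` into `ZMod p ^ n`, where the ring acts
  -- by scalars. Hence the preimage under `f` of any subspace is a submodule.
  let f : Q.P 1 → Fin n → ZMod p := fun z => (T (h (Q.d 0 z)) (0, 1)).1
  have hfsnd : ∀ z, (T (h (Q.d 0 z)) (0, 1)).2 = 0 := by
    intro z
    obtain ⟨θ, D, hD⟩ := exists_affineAction_eq φ U le_rfl (h (Q.d 0 z))
    have h0 : augmentation G (h (Q.d 0 z)) = (0 : ZHat) :=
      (haug _).trans ((Q.exact_zero _).2 ⟨z, rfl⟩)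
    change (affineAction φ U le_rfl (h (Q.d 0 z)) (0, 1)).2 = 0
    rw [hD, augMod_eq_zero h0]
    exact zero_mul _
  have hfc : Continuous f := continuous_fst.comp
    ((continuous_affineAction_apply φ U le_rfl (0, 1)).comp (h.continuous.comp (Q.d 0).continuous))
  let W : Submodule (ZMod p) (Fin n → ZMod p) :=
    Submodule.span (ZMod p) (Set.range fun j => f (y j))
  let M : Submodule (CompletedGroupAlgebra G) (Q.P 1) :=
    { carrier := {z | f z ∈ W}
      zero_mem' := by
        have : f 0 = 0 := by
          change (affineAction φ U le_rfl (h (Q.d 0 0)) (0, 1)).1 = 0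
          rw [map_zero, map_zero]
          exact congrArg (fun g => (g ((0, 1) : (Fin n → ZMod p) × ZMod p)).1)
            (map_zero (affineAction φ U le_rfl))
        exact (this ▸ W.zero_mem : f 0 ∈ W)
      add_mem' := by
        intro a b ha hb
        have : f (a + b) = f a + f b := by
          change (affineAction φ U le_rfl (h (Q.d 0 (a + b))) (0, 1)).1 = _
          rw [map_add, map_add]
          exact congrArg (fun g => (g ((0, 1) : (Fin n → ZMod p) × ZMod p)).1)
            (map_add (affineAction φ U le_rfl) (h (Q.d 0 a)) (h (Q.d 0 b)))
        exact (this ▸ W.add_mem ha hb : f (a + b) ∈ W)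
      smul_mem' := by
        intro r z hz
        obtain ⟨θ, D, hD⟩ := exists_affineAction_eq φ U le_rfl r
        have : f (r • z) = θ • f z := by
          change (affineAction φ U le_rfl (h (Q.d 0 (r • z))) (0, 1)).1 = _
          rw [map_smul, map_smul]
          have e := congrArg (fun g => (g ((0, 1) : (Fin n → ZMod p) × ZMod p)).1)
            (map_mul (affineAction φ U le_rfl) r (h (Q.d 0 z)))
          refine e.trans ?_
          simp only [Module.End.mul_apply]
          rw [hD]
          have := hfsnd z
          simp only [T] at this
          simp only [this, zero_smul, add_zero]
          rfl
        exact (this ▸ W.smul_mem θ hz : f (r • z) ∈ W) }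
  have hMc : IsClosed (M : Set (Q.P 1)) := (isClosed_discrete (W : Set (Fin n → ZMod p))).preimage hfc
  have hMspan : Submodule.span (CompletedGroupAlgebra G) (Set.range y) ≤ M := by
    rw [Submodule.span_le]
    rintro _ ⟨j, rfl⟩
    exact Submodule.subset_span (s := Set.range fun j => f (y j)) ⟨j, rfl⟩
  have hM : ∀ z, f z ∈ W := fun z => hMc.closure_subset_iff.2 hMspan (hy z)
  obtain ⟨x, hx⟩ := Q.surjective (1 : ZHat)
  have hW : W = ⊤ := by
    rw [eq_top_iff]
    intro v _
    obtain ⟨u, hu⟩ := GStar.exists_vec_eq v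
    obtain ⟨g, hg⟩ := hsurj (GStar.inl u)
    -- Since `g - 1` kills the trivial module, `r • x` is a boundary. On a vector with last
    -- coordinate `1`, the translation by `v` minus the identity yields exactly `v`.
    let r : CompletedGroupAlgebra G := CompletedGroupAlgebra.of g - 1
    have hr : Q.ε (r • x) = 0 := by
      rw [map_smul]
      change augmentation G r * _ = (0 : ZHat)
      rw [map_sub, augmentation_of, map_one, sub_self]
      exact zero_mul (M₀ := ZHat) _
    obtain ⟨z, hz⟩ := (Q.exact_zero _).1 hr
    have : f z = v := by
      obtain ⟨θ, D, hD⟩ := exists_affineAction_eq φ U le_rfl (h x)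
      have h1 : (T (h x) (0, 1)).2 = 1 := by
        change (affineAction φ U le_rfl (h x) (0, 1)).2 = 1
        rw [hD, augMod_eq_one ((haug x).trans hx)]
        exact mul_one _
      have h2 : f z = (T r (T (h x) (0, 1))).1 := by
        change (T (h (Q.d 0 z)) (0, 1)).1 = _
        rw [hz, map_smul]
        exact congrArg (fun g => (g ((0, 1) : (Fin n → ZMod p) × ZMod p)).1) (map_mul T r (h x))
      have h3 : T r = GStar.affine p n (GStar.inl u) - 1 := by
        rw [← hg, ← affineAction_of φ U le_rfl g, ← map_one T]
        exact map_sub T _ _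
      rw [h2, h3, LinearMap.sub_apply, Prod.fst_sub]
      change Cyc.scal p (GStar.right (GStar.inl u)) • _ + _ • (GStar.inl u).vec - _ = v
      rw [h1, hu]
      simp
    exact this ▸ hM z
  have h1 : Module.finrank (ZMod p) W ≤ k :=
    (finrank_range_le_card (R := ZMod p) fun j => f (y j)).trans_eq (Fintype.card_fin k)
  rwa [hW, finrank_top, Module.finrank_fin_fun] at h1

theorem ProfMod.IsPFG.isFG {R : Type} [Ring R] [TopologicalSpace R] {M : ProfMod R}
    (h : M.IsPFG) : M.IsFG := by
  obtain ⟨k, _, hk⟩ := h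
  by_contra hM
  have : {x : Fin k → M | M.Generates x} = ∅ :=
    Set.eq_empty_iff_forall_notMem.2 fun x hx => hM ⟨k, x, hx⟩
  rw [this, MeasureTheory.measure_empty] at hk
  exact hk.false

theorem GroupTypePFP.groupTypeFP {G : Type} [Group G] [TopologicalSpace G] {n : ℕ}
    (h : GroupTypePFP G n) : GroupTypeFP G n := by
  obtain ⟨Q, hQ⟩ := h
  exact ⟨Q, fun i hi => (hQ i hi).isFG⟩

theorem GStar.finite (p n : ℕ) (hp : p ≠ 0) : Finite (GStar p n) := by
  have : NeZero p := ⟨hp⟩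
  have : Finite (Cyc p) := inferInstanceAs (Finite (ZMod p))
  have : Finite (MulAut (Cyc p)) := Finite.of_injective _ (Cyc.scal_injective p)
  have : Finite (oddAut p) := inferInstance
  exact Finite.of_injective (fun g : GStar p n => (g.left, GStar.right g)) fun g h e =>
    GStar.ext (congrArg Prod.fst e) (congrArg Prod.snd e)

theorem not_groupTypeFP_pi_gstar (p n : ℕ → ℕ) (hp : ∀ i, (p i).Prime)
    (hn : Filter.Tendsto n Filter.atTop Filter.atTop) :
    ¬ GroupTypeFP (∀ i, GStar (p i) (n i)) 1 := by
  intro h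
  have := fun i => GStar.finite (p i) (n i) (hp i).ne_zero
  obtain ⟨k, hk⟩ := h.exists_rank_le
  obtain ⟨i, hi⟩ := (hn.eventually_gt_atTop k).exists
  have := Fact.mk (hp i)
  exact hi.not_ge (hk (p i) (n i) (Pi.evalMonoidHom _ i)
    (continuous_apply (A := fun i => GStar (p i) (n i)) i) (Function.surjective_eval i))

/-! ### Linear algebra: simple modules, extension of scalars, weight vectors -/

/-- As `M` is finite, `R` modulo the annihilator of `M` embeds in a finite power of `M` and is
semisimple. It maps onto `N`; a splitting followed by a suitable coordinate is a nonzero map between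
simple modules. -/
theorem IsSimpleModule.nonempty_linearEquiv_of_annihilator_le {R M N : Type*} [Ring R]
    [AddCommGroup M] [Module R M] [AddCommGroup N] [Module R N] [IsSimpleModule R M]
    [IsSimpleModule R N] [Finite M] (h : Module.annihilator R M ≤ Module.annihilator R N) :
    Nonempty (N ≃ₗ[R] M) := by
  have := IsSimpleModule.nontrivial R N
  obtain ⟨w, hw⟩ := exists_ne (0 : N)
  let f : R →ₗ[R] (M → M) := LinearMap.pi fun m => LinearMap.toSpanSingleton R M m
  let g : R →ₗ[R] N := LinearMap.toSpanSingleton R N w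
  have hg : Function.Surjective g := IsSimpleModule.toSpanSingleton_surjective R hw
  have hfg : LinearMap.ker f ≤ LinearMap.ker g := by
    intro r hr
    have hr' : r ∈ Module.annihilator R M :=
      Module.mem_annihilator.2 fun m => congrFun (LinearMap.mem_ker.1 hr) m
    exact Module.mem_annihilator.1 (h hr') w
  let q : LinearMap.range f →ₗ[R] N :=
    ((LinearMap.ker f).liftQ g hfg).comp f.quotKerEquivRange.symm.toLinearMap
  have hq : Function.Surjective q := by
    intro y
    obtain ⟨r, rfl⟩ := hg y
    exact ⟨f.quotKerEquivRange (Submodule.Quotient.mk r), by simp [q]⟩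
  obtain ⟨s, hs⟩ := IsSemisimpleModule.lifting_property q hq LinearMap.id
  have hsw : (s w : M → M) ≠ 0 := by
    intro h0
    have h1 : s w = 0 := Subtype.ext h0
    have h2 : q (s w) = w := congrArg (fun f => f w) hs
    exact hw (by rw [← h2, h1, map_zero])
  obtain ⟨m, hm⟩ := Function.ne_iff.1 hsw
  let e : N →ₗ[R] M := (LinearMap.proj m).comp ((LinearMap.range f).subtype.comp s)
  have he : e ≠ 0 := fun h0 => hm (congrArg (fun f => f w) h0)
  exact ⟨LinearEquiv.ofBijective e (LinearMap.bijective_of_ne_zero he)⟩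

theorem Representation.nonempty_equiv_of_annihilator_le {F G V W : Type*} [Field F] [Group G]
    [AddCommGroup V] [Module F V] [AddCommGroup W] [Module F W] [Finite V]
    (ρ : Representation F G V) (σ : Representation F G W) [ρ.IsIrreducible] [σ.IsIrreducible]
    (h : Module.annihilator (MonoidAlgebra F G) ρ.asModule ≤
      Module.annihilator (MonoidAlgebra F G) σ.asModule) : Nonempty (ρ.Equiv σ) := by
  have : Finite ρ.asModule := inferInstanceAs (Finite V)
  obtain ⟨e⟩ := IsSimpleModule.nonempty_linearEquiv_of_annihilator_le h
  let f := (IntertwiningMap.equivLinearMapAsModule σ ρ).symm e.toLinearMap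
  have hf : Function.Bijective f := e.bijective
  exact ⟨(IntertwiningMap.ofBijective f hf).symm⟩

/-! ### Detecting an irreducible representation on one vector over a larger field -/

section ExtendScalars

variable {F : Type} [Field F] (K : Type) [Field K] [Algebra F K] {m : ℕ}

/-- Extension of scalars for endomorphisms of coordinate spaces. -/
noncomputable def extendEnd (m : ℕ) : Module.End F (Fin m → F) →ₐ[F] Module.End K (Fin m → K) :=
  ((Matrix.toLinAlgEquiv' (R := K) (n := Fin m)).toAlgHom.restrictScalars F).comp
    ((Algebra.ofId F K).mapMatrix.comp LinearMap.toMatrixAlgEquiv'.toAlgHom)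

/-- The matrix of `T` has entries in `F`, so it commutes with applying an `F`-linear functional to
each coordinate. This brings vectors over `K` back to `F`. -/
theorem comp_extendEnd_apply (φ : K →ₗ[F] F) (T : Module.End F (Fin m → F)) (u : Fin m → K) :
    φ ∘ (extendEnd K m T u) = T (φ ∘ u) := by
  have h : T = Matrix.toLin' (LinearMap.toMatrix' T) := (Matrix.toLin'_toMatrix' T).symm
  funext i
  conv_rhs => rw [h]
  simp only [extendEnd, AlgHom.comp_apply, Function.comp_apply, Matrix.toLin'_apply, Matrix.mulVec,
    dotProduct]
  change φ (Matrix.toLin' ((LinearMap.toMatrix' T).map (algebraMap F K)) u i) = _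
  simp only [Matrix.toLin'_apply, Matrix.mulVec, dotProduct, map_sum, Matrix.map_apply]
  refine Finset.sum_congr rfl fun j _ => ?_
  rw [← Algebra.smul_def, map_smul, smul_eq_mul]

variable {G : Type} [Group G]

/-- A functional `K → F` that is nonzero on some coordinate of `v` turns `v` into a nonzero vector
over `F`, which generates the irreducible module. The factor `y` reaches every vector of it. -/
theorem mem_annihilator_asModule_iff (ρ : Representation F G (Fin m → F)) [ρ.IsIrreducible]
    {v : Fin m → K} (hv : v ≠ 0) (x : MonoidAlgebra F G) :
    x ∈ Module.annihilator (MonoidAlgebra F G) ρ.asModule ↔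
      ∀ y, extendEnd K m (ρ.asAlgebraHom (x * y)) v = 0 := by
  constructor
  · intro hx y
    have : ρ.asAlgebraHom x = 0 := LinearMap.ext fun w => Module.mem_annihilator.1 hx w
    simp [this]
  · intro h
    obtain ⟨i, hi⟩ := Function.ne_iff.1 hv
    obtain ⟨φ, hφ⟩ := Module.Projective.exists_dual_ne_zero F hi
    have hw : (ρ.asModuleEquiv.symm (φ ∘ v)) ≠ 0 := fun h0 => hφ (congrFun h0 i)
    rw [Module.mem_annihilator]
    intro u
    obtain ⟨y, rfl⟩ := IsSimpleModule.toSpanSingleton_surjective (MonoidAlgebra F G) hw u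
    rw [LinearMap.toSpanSingleton_apply, ← mul_smul]
    refine (comp_extendEnd_apply K φ (ρ.asAlgebraHom (x * y)) v).symm.trans ?_
    rw [h y]
    funext j
    exact map_zero φ

end ExtendScalars

/-- Applying `ρ x` and then a functional that is nonzero on one `w t` turns a relation among the
vectors into one among distinct characters, which Dedekind's theorem forbids. -/
theorem linearIndependent_of_weights {N K W T : Type*} [Monoid N] [Field K] [AddCommGroup W]
    [Module K W] (ρ : N →* Module.End K W) (χ : T → N →* K) (hχ : Function.Injective χ)
    (w : T → W) (hw : ∀ t, w t ≠ 0) (h : ∀ t x, ρ x (w t) = χ t x • w t) :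
    LinearIndependent K w := by
  rw [linearIndependent_iff']
  intro s c hc t ht
  by_contra hct
  obtain ⟨φ, hφ⟩ : ∃ φ : Module.Dual K W, φ (w t) ≠ 0 := by
    by_contra! hφ
    exact hw t ((Module.forall_dual_apply_eq_zero_iff K _).1 hφ)
  have hli := (linearIndependent_monoidHom N K).comp χ hχ
  rw [linearIndependent_iff'] at hli
  have h0 := hli s (fun t => c t * φ (w t)) (by
    funext x
    have := congrArg (fun v => φ (ρ x v)) hc
    simpa [h, mul_assoc, mul_comm, mul_left_comm] using this) t ht
  exact (mul_ne_zero hct hφ) h0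

/-- If some operator is not scalar, one of its eigenspaces is proper, nonzero and stable under the
whole family; induct on dimension. No diagonalisability is used, so the characteristic of `K` may be
one of the `p i`. -/
theorem exists_common_eigenvector {ι K : Type*} [Field K] [IsAlgClosed K] {W : Type*}
    [AddCommGroup W] [Module K W] [FiniteDimensional K W] [Nontrivial W]
    (f : ι → Module.End K W) (hf : ∀ i j, Commute (f i) (f j)) :
    ∃ v ≠ 0, ∀ i, ∃ μ : K, f i v = μ • v := by
  induction hd : Module.finrank K W using Nat.strong_induction_on generalizing W with
  | _ d ih =>
    subst hd
    by_cases hs : ∀ i, ∃ μ : K, f i = algebraMap K _ μ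
    · obtain ⟨v, hv⟩ := exists_ne (0 : W)
      refine ⟨v, hv, fun i => ?_⟩
      obtain ⟨μ, hμ⟩ := hs i
      exact ⟨μ, by rw [hμ]; rfl⟩
    · push Not at hs
      obtain ⟨i, hi⟩ := hs
      obtain ⟨μ, hμ⟩ := Module.End.exists_eigenvalue (f i)
      let E := (f i).eigenspace μ
      have hE : E ≠ ⊤ := by
        intro h
        refine hi μ (LinearMap.ext fun v => ?_)
        have : v ∈ E := h ▸ Submodule.mem_top
        exact Module.End.mem_eigenspace_iff.1 this
      have hm : ∀ j, Set.MapsTo (f j) E E := by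
        intro j v hv
        rw [SetLike.mem_coe, Module.End.mem_eigenspace_iff] at hv ⊢
        rw [← Module.End.mul_apply, (hf i j).eq, Module.End.mul_apply, hv, map_smul]
      have : Nontrivial E := Submodule.nontrivial_iff_ne_bot.2 hμ
      obtain ⟨v, hv, h⟩ := ih _ (Submodule.finrank_lt hE) (fun j => (f j).restrict (hm j))
        (fun j k => LinearMap.ext fun v => Subtype.ext
          (congrArg (fun g => g (v : W)) (hf j k).eq)) rfl
      refine ⟨v, fun h0 => hv (Subtype.ext h0), fun j => ?_⟩
      obtain ⟨ν, hν⟩ := h j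
      exact ⟨ν, congrArg Subtype.val hν⟩

section Monomial

variable {F K G W T : Type*} [Field F] [Field K] [Algebra F K] [Group G] [AddCommGroup W]
  [Module K W] [Module F W] [IsScalarTower F K W]

/-- The point is that the inner formal combination depends on `x`, `c` and `s` only, so two
representations obeying the same rule share it. -/
theorem apply_eq_linearCombination (Φ : MonoidAlgebra F G →ₐ[F] Module.End K W) (v : W)
    (c : G → K) (s : G → T) (w : T → W) (h : ∀ g, Φ (.of F G g) v = c g • w (s g))
    (x : MonoidAlgebra F G) :
    Φ x v = Finsupp.linearCombination K w
      (Finsupp.linearCombination F (fun g => Finsupp.single (s g) (c g)) x.coeff) := by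
  induction x using MonoidAlgebra.induction_on with
  | of g => rw [h]; simp
  | add x y hx hy => simp [hx, hy]
  | smul r x hx =>
    rw [map_smul, LinearMap.smul_apply, hx, MonoidAlgebra.coeff_smul, map_smul,
      LinearMap.map_smul_of_tower]

end Monomial

/-- Two irreducible representations are isomorphic if, after an extension of scalars, they contain
vectors on which `G` acts by the same monomial rule. -/
theorem Representation.nonempty_equiv_of_monomial {F K G T : Type} [Field F] [Finite F] [Field K]
    [Algebra F K] [Group G] {m : ℕ} (ρ σ : Representation F G (Fin m → F)) [ρ.IsIrreducible]
    [σ.IsIrreducible] (c : G → K) (s : G → T) {v u : Fin m → K} (hv : v ≠ 0) (hu : u ≠ 0)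
    {w w' : T → Fin m → K} (hw : LinearIndependent K w)
    (h : ∀ g, extendEnd K m (ρ g) v = c g • w (s g))
    (h' : ∀ g, extendEnd K m (σ g) u = c g • w' (s g)) : Nonempty (ρ.Equiv σ) := by
  refine ρ.nonempty_equiv_of_annihilator_le σ fun x hx => ?_
  rw [mem_annihilator_asModule_iff K ρ hv] at hx
  rw [mem_annihilator_asModule_iff K σ hu]
  intro y
  have h1 := apply_eq_linearCombination ((extendEnd K m).comp ρ.asAlgebraHom) v c s w
    (fun g => by simpa using h g) (x * y)
  have h2 := apply_eq_linearCombination ((extendEnd K m).comp σ.asAlgebraHom) u c s w'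
    (fun g => by simpa using h' g) (x * y)
  -- Independence of `w` forces the shared formal combination to vanish, so its evaluation at `w'`
  -- vanishes too; `w'` need not be independent.
  rw [AlgHom.comp_apply, hx y, eq_comm, ← map_zero (Finsupp.linearCombination K w)] at h1
  rw [AlgHom.comp_apply, hw h1, map_zero] at h2
  exact h2

/-! ### Weights of representations of the product -/

/-- Homomorphisms on a product of groups agree if they agree on all factors and on a tail. -/
theorem MonoidHom.pi_ext_of_tail {H : ℕ → Type*} [∀ i, Group (H i)] {M : Type*} [Monoid M]
    {f g : (∀ i, H i) →* M} (k : ℕ) (hk : ∀ x, (∀ i < k, x i = 1) → f x = g x)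
    (h : ∀ i x, f (Pi.mulSingle i x) = g (Pi.mulSingle i x)) : f = g := by
  induction k with
  | zero => exact MonoidHom.ext fun x => hk x (by simp)
  | succ k ih =>
    refine ih fun x hx => ?_
    have e : x = Pi.mulSingle k (x k) * Function.update x k 1 := by
      funext i
      by_cases hi : i = k
      · subst hi; simp
      · simp [hi]
    rw [e, map_mul, map_mul, h, hk]
    intro i hi
    by_cases hik : i = k
    · subst hik; simp
    · rw [Function.update_of_ne hik]
      exact hx i (by omega)

/-- A homomorphism on a product that is trivial on all elements whose first `k` components are
trivial. -/
def TailTrivial {H : ℕ → Type*} [∀ i, Group (H i)] {M : Type*} [Monoid M] (k : ℕ)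
    (f : (∀ i, H i) →* M) : Prop :=
  ∀ x, (∀ i < k, x i = 1) → f x = 1

theorem TailTrivial.mono {H : ℕ → Type*} [∀ i, Group (H i)] {M : Type*} [Monoid M] {k l : ℕ}
    {f : (∀ i, H i) →* M} (h : TailTrivial k f) (hkl : k ≤ l) : TailTrivial l f :=
  fun x hx => h x fun i hi => hx i (hi.trans_le hkl)

/-- The kernel is open, so it contains a basic neighbourhood of `1`, which constrains only finitely
many coordinates. -/
theorem exists_tailTrivial {H : ℕ → Type*} [∀ i, Group (H i)] [∀ i, TopologicalSpace (H i)]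
    {M : Type*} [Monoid M] (f : (∀ i, H i) →* M) (hf : @Continuous _ M _ ⊥ f) :
    ∃ k, TailTrivial k f := by
  let _ : TopologicalSpace M := ⊥
  have : DiscreteTopology M := ⟨rfl⟩
  have ho : IsOpen (f ⁻¹' {1}) := (isOpen_discrete _).preimage hf
  obtain ⟨I, u, hu, hI⟩ := isOpen_pi_iff.1 ho 1 (by simp)
  refine ⟨I.sup id + 1, fun x hx => ?_⟩
  have hxI : x ∈ (I : Set ℕ).pi u := by
    intro i hi
    rw [hx i (Nat.lt_succ_of_le (Finset.le_sup (f := id) hi))]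
    exact (hu i hi).2
  exact hI hxI

/-! ### Structure of the odd-order automorphism group -/

section OddAut

variable {p : ℕ}

/-- The group `MulAut (Cyc p)` is cyclic of order `p - 1`, which is twice an odd number, so its
elements of odd order are exactly the squares. -/
theorem oddAut_card_and_generator (hp : p.Prime) (hmod : p % 4 = 3) :
    Nat.card (oddAut p) = (p - 1) / 2 ∧ IsCyclic (oddAut p) := by
  have := Fact.mk hp
  have hcard : Nat.card (Cyc p) = p := Nat.card_zmod p
  have e : MulAut (Cyc p) ≃* (ZMod p)ˣ := by
    have e := IsCyclic.mulAutMulEquiv (Cyc p)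
    rwa [hcard] at e
  have hc : IsCyclic (MulAut (Cyc p)) := isCyclic_of_surjective e.symm e.symm.surjective
  have : Finite (MulAut (Cyc p)) := Finite.of_equiv _ e.symm.toEquiv
  have hN : Nat.card (MulAut (Cyc p)) = p - 1 := by
    rw [Nat.card_congr e.toEquiv, Nat.card_eq_fintype_card, ZMod.card_units]
  obtain ⟨g, hg⟩ := hc.exists_generator
  have hog : orderOf g = p - 1 := by rw [orderOf_eq_card_of_forall_mem_zpowers hg, hN]
  have hodd : oddAut p = Subgroup.zpowers (g ^ 2) := by
    ext a
    constructor
    · intro ha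
      have ha : Odd (orderOf a) := ha
      obtain ⟨k, hk⟩ := ha
      obtain ⟨l, rfl⟩ := hg a
      refine ⟨l * (k + 1), ?_⟩
      have h1 : (g ^ l) ^ (2 * k + 1) = 1 := hk ▸ pow_orderOf_eq_one _
      change (g ^ 2) ^ (l * (k + 1)) = g ^ l
      calc (g ^ 2) ^ (l * (k + 1)) = (g ^ l) ^ (2 * k + 1) * g ^ l := by
            rw [← zpow_natCast, ← zpow_natCast, ← zpow_mul, ← zpow_mul, ← zpow_add]
            congr 1; push_cast; ring
        _ = g ^ l := by rw [h1, one_mul]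
    · intro ha
      have h2 : orderOf a ∣ (p - 1) / 2 := by
        refine (orderOf_dvd_of_mem_zpowers ha).trans ?_
        apply orderOf_dvd_of_pow_eq_one
        rw [← pow_mul, Nat.mul_div_cancel' (by omega), ← hog, pow_orderOf_eq_one]
      have h3 : Odd ((p - 1) / 2) := by rw [Nat.odd_iff]; omega
      exact h3.of_dvd_nat h2
  constructor
  · rw [hodd, Nat.card_zpowers, orderOf_pow, hog, Nat.gcd_eq_right (by omega)]
  · infer_instance

end OddAut

/-- A nontrivial character of `C_p ^ n` has trivial stabiliser in `Aut(C_p)°`. -/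
theorem eq_one_of_character_invariant {p n : ℕ} (hp : p.Prime) {K : Type*} [Field K]
    (χ : (Fin n → Cyc p) →* K) (hχ : χ ≠ 1) (a : oddAut p)
    (h : ∀ x, χ (diagAction p n a x) = χ x) : a = 1 := by
  have := Fact.mk hp
  by_contra ha
  have hs : Cyc.scal p a - 1 ≠ 0 := by
    intro h0
    exact ha (Subtype.ext (Cyc.scal_injective p (by rw [sub_eq_zero.1 h0]; simp)))
  refine hχ (MonoidHom.ext fun y => ?_)
  -- Additively `z` solves `(a - 1) z = y`, so invariance of `χ` at `z` says `χ y = 1`.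
  let z : Fin n → Cyc p := fun j => ofAdd ((Cyc.scal p a - 1)⁻¹ * toAdd (y j))
  have hz : diagAction p n a z = z * y := by
    funext j
    apply toAdd.injective
    rw [GStar.toAdd_diagAction, Pi.mul_apply, toAdd_mul]
    have : toAdd (z j) = (Cyc.scal p a - 1)⁻¹ * toAdd (y j) := rfl
    rw [this]
    field_simp
    ring
  have h1 := h z
  rw [hz, map_mul] at h1
  have h2 : χ z ≠ 0 := by
    intro h0
    have := map_mul χ z z⁻¹
    rw [mul_inv_cancel, map_one, h0, zero_mul] at this
    exact one_ne_zero this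
  exact mul_left_cancel₀ h2 (by rw [h1]; simp)

/-! ### Weight vectors and their orbits -/

section Weights

variable {p n : ℕ → ℕ}

/-- The inclusion of `∏ C_{p_i} ^ {n_i}`. -/
def inlPi : (∀ i, Fin (n i) → Cyc (p i)) →* ∀ i, GStar (p i) (n i) :=
  MonoidHom.pi fun i => GStar.inl.comp (Pi.evalMonoidHom _ i)

/-- The inclusion of `∏ Aut(C_{p_i})°`. -/
def inrPi : (∀ i, oddAut (p i)) →* ∀ i, GStar (p i) (n i) :=
  MonoidHom.pi fun i => GStar.inr.comp (Pi.evalMonoidHom _ i)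

variable (n) in
/-- The action of `∏ Aut(C_{p_i})°` on `∏ C_{p_i} ^ {n_i}`. -/
def actPi (a : ∀ i, oddAut (p i)) :
    (∀ i, Fin (n i) → Cyc (p i)) →* ∀ i, Fin (n i) → Cyc (p i) :=
  MonoidHom.pi fun i => (diagAction (p i) (n i) (a i)).toMonoidHom.comp (Pi.evalMonoidHom _ i)

theorem actPi_inv_actPi (a : ∀ i, oddAut (p i)) (x : ∀ i, Fin (n i) → Cyc (p i)) :
    actPi n a (actPi n a⁻¹ x) = x := by
  funext i
  change diagAction (p i) (n i) (a i) (diagAction (p i) (n i) (a i)⁻¹ (x i)) = x i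
  rw [← MulAut.mul_apply, ← map_mul, mul_inv_cancel, map_one, MulAut.one_apply]

theorem inlPi_mul_inrPi (a : ∀ i, oddAut (p i)) (x : ∀ i, Fin (n i) → Cyc (p i)) :
    (inlPi x * inrPi a : ∀ i, GStar (p i) (n i)) = inrPi a * inlPi (actPi n a⁻¹ x) := by
  funext i
  have h := GStar.inr_mul_inl (a i) (actPi n a⁻¹ x i)
  have h2 : diagAction (p i) (n i) (a i) (actPi n a⁻¹ x i) = x i :=
    congrFun (actPi_inv_actPi a x) i
  rw [h2] at h
  exact h.symm

theorem actPi_mulSingle (a : ∀ i, oddAut (p i)) (i : ℕ) (x : Fin (n i) → Cyc (p i)) :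
    actPi n a (Pi.mulSingle i x) = Pi.mulSingle i (diagAction (p i) (n i) (a i) x) := by
  funext j
  change diagAction (p j) (n j) (a j) (Pi.mulSingle (M := fun i => Fin (n i) → Cyc (p i)) i x j) = _
  by_cases hj : j = i
  · subst hj; simp
  · simp [Pi.mulSingle_eq_of_ne hj]

variable {K : Type} [Field K]

/-- The index `i` belongs to the support of the character `χ`. -/
def InSupp (χ : (∀ i, Fin (n i) → Cyc (p i)) →* K) (i : ℕ) : Prop :=
  χ.comp (MonoidHom.mulSingle _ i) ≠ 1

theorem InSupp.lt {χ : (∀ i, Fin (n i) → Cyc (p i)) →* K} {k i : ℕ} (hχ : TailTrivial k χ)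
    (hi : InSupp χ i) : i < k := by
  by_contra hk
  refine hi (MonoidHom.ext fun x => hχ _ fun j hj => ?_)
  exact Pi.mulSingle_eq_of_ne (by omega) _

theorem apply_mulSingle_of_not_inSupp {χ : (∀ i, Fin (n i) → Cyc (p i)) →* K} {i : ℕ}
    (hi : ¬ InSupp χ i) (x : Fin (n i) → Cyc (p i)) : χ (Pi.mulSingle i x) = 1 := by
  rw [InSupp, not_not] at hi
  exact congrArg (fun f => f x) hi

theorem comp_actPi_eq {χ : (∀ i, Fin (n i) → Cyc (p i)) →* K} {k : ℕ} (hχ : TailTrivial k χ)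
    (a : ∀ i, oddAut (p i)) (ha : ∀ i, InSupp χ i → a i = 1) : χ.comp (actPi n a) = χ := by
  refine MonoidHom.pi_ext_of_tail k (fun x hx => ?_) fun i x => ?_
  · rw [hχ x hx]
    refine hχ _ fun i hi => ?_
    change diagAction (p i) (n i) (a i) (x i) = 1
    rw [hx i hi, map_one]
  · rw [MonoidHom.comp_apply, actPi_mulSingle]
    by_cases hi : InSupp χ i
    · rw [ha i hi, map_one, MulAut.one_apply]
    · rw [apply_mulSingle_of_not_inSupp hi, apply_mulSingle_of_not_inSupp hi]

open Classical in
/-- Extension by `1` of a family on the support of `χ`. -/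
noncomputable def extendOne (χ : (∀ i, Fin (n i) → Cyc (p i)) →* K)
    (τ : ∀ i : {i // InSupp χ i}, oddAut (p i)) : ∀ i, oddAut (p i) :=
  fun i => if h : InSupp χ i then τ ⟨i, h⟩ else 1

open Classical in
/-- The components of `a` off the support of `χ`. -/
noncomputable def offSupp (χ : (∀ i, Fin (n i) → Cyc (p i)) →* K) (a : ∀ i, oddAut (p i)) :
    ∀ i, oddAut (p i) :=
  fun i => if InSupp χ i then 1 else a i

/-- The vector `v` has weight `χ` and is an eigenvector for the components of `γ` off the support
of `χ`, with eigenvalue `lam`. -/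
structure IsWeightVector {W : Type} [AddCommGroup W] [Module K W] (γ : ∀ i, oddAut (p i))
    (ρ : (∀ i, GStar (p i) (n i)) →* Module.End K W) (χ : (∀ i, Fin (n i) → Cyc (p i)) →* K)
    (lam : K) (v : W) : Prop where
  ne_zero : v ≠ 0
  inlPi_apply : ∀ x, ρ (inlPi x) v = χ x • v
  inrPi_apply : ρ (inrPi (offSupp χ γ)) v = lam • v

variable {W : Type} [AddCommGroup W] [Module K W] {γ : ∀ i, oddAut (p i)}
  {ρ : (∀ i, GStar (p i) (n i)) →* Module.End K W}

theorem tailTrivial_of_weight {k : ℕ} (hρ : TailTrivial k ρ)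
    {χ : (∀ i, Fin (n i) → Cyc (p i)) →* K} {v : W} (hv : v ≠ 0)
    (h : ∀ x, ρ (inlPi x) v = χ x • v) : TailTrivial k χ := by
  intro x hx
  have h1 : ρ (inlPi x) = 1 := hρ _ fun i hi => by
    change GStar.inl (x i) = 1
    rw [hx i hi, map_one]
  have h2 := h x
  rw [h1, Module.End.one_apply] at h2
  exact smul_left_injective K hv (by simpa using h2.symm)

theorem weight_inrPi_apply {χ : (∀ i, Fin (n i) → Cyc (p i)) →* K} {v : W}
    (h : ∀ x, ρ (inlPi x) v = χ x • v) (a : ∀ i, oddAut (p i)) (x : ∀ i, Fin (n i) → Cyc (p i)) :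
    ρ (inlPi x) (ρ (inrPi a) v) = χ (actPi n a⁻¹ x) • ρ (inrPi a) v := by
  rw [← Module.End.mul_apply, ← map_mul, inlPi_mul_inrPi, map_mul, Module.End.mul_apply, h, map_smul]

/-- Automorphisms supported off the support of `χ` fix `χ`, so they preserve its weight space `E`,
and an eigenvector can be chosen inside `E`. -/
theorem exists_isWeightVector [IsAlgClosed K] [FiniteDimensional K W] [Nontrivial W] {k : ℕ}
    (hρ : TailTrivial k ρ) (γ : ∀ i, oddAut (p i)) :
    ∃ χ lam v, IsWeightVector γ ρ χ lam v := by
  obtain ⟨v, hv, h⟩ := exists_common_eigenvector (fun x => ρ (inlPi x)) fun x y => by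
    change _ * _ = _ * _
    rw [← map_mul, ← map_mul, ← map_mul, ← map_mul, mul_comm]
  choose μ hμ using h
  let χ : (∀ i, Fin (n i) → Cyc (p i)) →* K :=
    { toFun := μ
      map_one' := smul_left_injective K hv (by simp [← hμ])
      map_mul' := fun x y => smul_left_injective K hv (by
        change μ (x * y) • v = (μ x * μ y) • v
        rw [← hμ, map_mul, map_mul, Module.End.mul_apply, hμ, map_smul, hμ, smul_smul, mul_comm]) }
  have hχ : TailTrivial k χ := tailTrivial_of_weight hρ hv hμ
  let E : Submodule K W := ⨅ x, (ρ (inlPi x)).eigenspace (χ x)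
  have hE : ∀ w, w ∈ E ↔ ∀ x, ρ (inlPi x) w = χ x • w := by
    intro w
    simp [E, Submodule.mem_iInf]
  have : Nontrivial E := ⟨⟨v, (hE v).2 hμ⟩, 0, fun h0 => hv (congrArg Subtype.val h0)⟩
  have hmaps : Set.MapsTo (ρ (inrPi (offSupp χ γ))) E E := by
    intro w hw
    rw [SetLike.mem_coe, hE] at hw ⊢
    intro x
    rw [weight_inrPi_apply hw]
    congr 1
    refine congrArg (fun f => f x) (comp_actPi_eq hχ _ fun i hi => ?_)
    simp [offSupp, hi]
  obtain ⟨lam, hlam⟩ := Module.End.exists_eigenvalue ((ρ (inrPi (offSupp χ γ))).restrict hmaps)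
  obtain ⟨w, hw⟩ := hlam.exists_hasEigenvector
  refine ⟨χ, lam, w, fun h0 => hw.2 (Subtype.ext h0), (hE w).1 w.2, ?_⟩
  exact congrArg Subtype.val hw.apply_eq_smul

/-- The translates are nonzero weight vectors for conjugates of `χ`. These conjugates are distinct
because every nontrivial component of `χ` has trivial stabiliser. -/
theorem IsWeightVector.linearIndependent (hp : ∀ i, (p i).Prime)
    {χ : (∀ i, Fin (n i) → Cyc (p i)) →* K} {lam : K} {v : W}
    (h : IsWeightVector γ ρ χ lam v) :
    LinearIndependent K fun τ => ρ (inrPi (extendOne χ τ)) v := by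
  refine linearIndependent_of_weights (ρ.comp inlPi)
    (fun τ => χ.comp (actPi n (extendOne χ τ)⁻¹)) ?_ _ (fun τ h0 => ?_)
    fun τ x => weight_inrPi_apply h.inlPi_apply _ x
  · intro τ σ hτσ
    funext ⟨i, hi⟩
    have hti : ∀ τ, extendOne χ τ i = τ ⟨i, hi⟩ := fun τ => by simp [extendOne, hi]
    have hx : ∀ x, χ (Pi.mulSingle i (diagAction (p i) (n i) (τ ⟨i, hi⟩)⁻¹ x)) =
        χ (Pi.mulSingle i (diagAction (p i) (n i) (σ ⟨i, hi⟩)⁻¹ x)) := by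
      intro x
      have := congrArg (fun f => f (Pi.mulSingle i x)) hτσ
      simpa only [MonoidHom.comp_apply, actPi_mulSingle, Pi.inv_apply, hti] using this
    have := eq_one_of_character_invariant (hp i)
      (χ.comp (MonoidHom.mulSingle (fun i => Fin (n i) → Cyc (p i)) i)) hi
      ((τ ⟨i, hi⟩)⁻¹ * σ ⟨i, hi⟩) fun x => by
        have := hx (diagAction (p i) (n i) (σ ⟨i, hi⟩) x)
        rw [← MulAut.mul_apply, ← MulAut.mul_apply, ← map_mul, ← map_mul, inv_mul_cancel,
          map_one, MulAut.one_apply] at this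
        exact this
    exact (inv_mul_eq_one.1 this)
  · refine h.ne_zero ?_
    have := congrArg (ρ (inrPi (extendOne χ τ)⁻¹)) h0
    rwa [map_zero, ← Module.End.mul_apply, ← map_mul, ← map_mul, inv_mul_cancel, map_one, map_one,
      Module.End.one_apply] at this

/-- The product of the orders `(p_i - 1) / 2` over the support of a weight is at most the
dimension. -/
theorem IsWeightVector.prod_le (hp : ∀ i, (p i).Prime) (hmod : ∀ i, p i % 4 = 3)
    [FiniteDimensional K W] {χ : (∀ i, Fin (n i) → Cyc (p i)) →* K} {lam : K} {v : W}
    (h : IsWeightVector γ ρ χ lam v) (S : Finset ℕ) (hS : ∀ i, i ∈ S ↔ InSupp χ i) :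
    ∏ i ∈ S, (p i - 1) / 2 ≤ Module.finrank K W := by
  have hfin : ∀ i, Finite (oddAut (p i)) := fun i => Nat.finite_of_card_ne_zero (by
    rw [(oddAut_card_and_generator (hp i) (hmod i)).1]
    have := hmod i
    have := (hp i).two_le
    omega)
  let _ : Fintype {i // InSupp χ i} := Fintype.subtype S hS
  have : Finite (∀ i : {i // InSupp χ i}, oddAut (p i)) := inferInstance
  let _ := Fintype.ofFinite (∀ i : {i // InSupp χ i}, oddAut (p i))
  have h1 := (h.linearIndependent hp).fintype_card_le_finrank
  rw [← Nat.card_eq_fintype_card, Nat.card_pi] at h1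
  refine le_trans (le_of_eq ?_) h1
  rw [Finset.prod_congr rfl fun i _ => (oddAut_card_and_generator (hp i) (hmod i)).1.symm]
  exact (Finset.prod_subtype S hS fun i => Nat.card (oddAut (p i)))

/-- Off the support of `χ`, and up to a tail, every element of `∏ Aut(C_{p_i})°` is a power of a
fixed family of generators. -/
theorem exists_pow_eq (hp : ∀ i, (p i).Prime) (hmod : ∀ i, p i % 4 = 3)
    (hcop : Pairwise fun i j => Nat.Coprime ((p i - 1) / 2) ((p j - 1) / 2))
    (hγ : ∀ i a, a ∈ Subgroup.zpowers (γ i)) (a : ∀ i, oddAut (p i)) (k : ℕ) :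
    ∃ l : ℕ, ∀ i < k, a i = γ i ^ l := by
  have hord : ∀ i, orderOf (γ i) = (p i - 1) / 2 := fun i => by
    rw [orderOf_eq_card_of_forall_mem_zpowers (hγ i), (oddAut_card_and_generator (hp i) (hmod i)).1]
  have hpos : ∀ i, orderOf (γ i) ≠ 0 := fun i => by
    have := hmod i
    have := (hp i).two_le
    rw [hord]
    omega
  have hpow : ∀ i, ∃ b : ℕ, γ i ^ b = a i := fun i =>
    ((isOfFinOrder_iff_pow_eq_one.2 ⟨_, Nat.pos_of_ne_zero (hpos i), pow_orderOf_eq_one _⟩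
      ).mem_powers_iff_mem_zpowers).2 (hγ i (a i))
  choose b hb using hpow
  -- Coprimality of the `(p i - 1) / 2` enters here: one exponent serves all `i < k`.
  obtain ⟨l, hl⟩ := Nat.chineseRemainderOfFinset b (fun i => orderOf (γ i)) (Finset.range k)
    (fun i _ => hpos i) (fun i _ j _ hij => by
      simpa only [Function.onFun, hord] using hcop hij)
  refine ⟨l, fun i hi => ?_⟩
  rw [← hb i, eq_comm]
  exact pow_eq_pow_iff_modEq.2 (hl i (Finset.mem_range.2 hi))

/-- This is the monomial rule: its coefficient depends only on `χ`, `lam`, `g` and `l`, and its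
vector only on the components of `g` in the support. -/
theorem IsWeightVector.apply_eq {χ : (∀ i, Fin (n i) → Cyc (p i)) →* K} {lam : K} {v : W}
    (h : IsWeightVector γ ρ χ lam v) {k : ℕ} (hρ : TailTrivial k ρ)
    (g : ∀ i, GStar (p i) (n i)) (l : ℕ) (hl : ∀ i < k, GStar.right (g i) = γ i ^ l) :
    ρ g v = (χ (actPi n (extendOne χ fun i => GStar.right (g i))⁻¹ fun i => (g i).left) * lam ^ l) •
      ρ (inrPi (extendOne χ fun i => GStar.right (g i))) v := by
  set b := extendOne χ fun i => GStar.right (g i)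
  -- The error term `t` is trivial below `k`, hence invisible to `ρ`.
  let t : ∀ i, oddAut (p i) := (offSupp χ γ ^ l)⁻¹ * b⁻¹ * fun i => GStar.right (g i)
  have hg : g = inlPi (fun i => (g i).left) * (inrPi b * (inrPi (offSupp χ γ) ^ l * inrPi t)) := by
    rw [← map_pow, ← map_mul, ← map_mul]
    have : b * (offSupp χ γ ^ l * t) = fun i => GStar.right (g i) := by
      simp [t, mul_assoc]
    rw [this]
    funext i
    exact (GStar.inl_left_mul_inr_right (g i)).symm
  have ht : ρ (inrPi t) = 1 := hρ _ fun i hi => by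
    have : t i = 1 := by
      change (offSupp χ γ i ^ l)⁻¹ * (b i)⁻¹ * GStar.right (g i) = 1
      by_cases hs : InSupp χ i
      · simp [b, offSupp, extendOne, hs]
      · simp [b, offSupp, extendOne, hs, hl i hi]
    change GStar.inr (t i) = 1
    rw [this, map_one]
  have hpow : ∀ l, (ρ (inrPi (offSupp χ γ)) ^ l) v = lam ^ l • v := by
    intro l
    induction l with
    | zero => simp
    | succ l ih => rw [pow_succ, Module.End.mul_apply, h.inrPi_apply, map_smul, ih, smul_smul,
        pow_succ']
  conv_lhs => rw [hg]
  rw [map_mul, map_mul, map_mul, ht, mul_one, map_pow, Module.End.mul_apply, Module.End.mul_apply,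
    hpow, map_smul, map_smul, weight_inrPi_apply h.inlPi_apply, smul_smul, mul_comm]

end Weights

/-! ### Counting weights -/

/-- Dedekind: the characters are independent in a space of dimension `Nat.card V`. -/
theorem finite_and_card_monoidHom_le (V K : Type) [Monoid V] [Finite V] [Field K] :
    Finite (V →* K) ∧ Nat.card (V →* K) ≤ Nat.card V := by
  let _ := Fintype.ofFinite V
  have hli := linearIndependent_monoidHom V K
  have : Finite (V →* K) := hli.finite
  let _ := Fintype.ofFinite (V →* K)
  refine ⟨this, ?_⟩
  have := hli.fintype_card_le_finrank
  rwa [Module.finrank_fintype_fun_eq_card, ← Nat.card_eq_fintype_card,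
    ← Nat.card_eq_fintype_card] at this

theorem Finset.sum_le_prod_of_two_le {ι : Type*} (S : Finset ι) (f : ι → ℕ)
    (hf : ∀ i ∈ S, 2 ≤ f i) : ∑ i ∈ S, f i ≤ ∏ i ∈ S, f i := by
  classical
  -- The inductive step `a + s ≤ a * t` for `s ≤ t` needs `2 ≤ t`, so the empty set is kept apart.
  suffices h : (∑ i ∈ S, f i = 0 ∧ ∏ i ∈ S, f i = 1) ∨
      (∑ i ∈ S, f i ≤ ∏ i ∈ S, f i ∧ 2 ≤ ∏ i ∈ S, f i) by omega
  induction S using Finset.induction_on with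
  | empty => simp
  | insert a S ha ih =>
    have h2 := hf a (Finset.mem_insert_self a S)
    rw [Finset.sum_insert ha, Finset.prod_insert ha]
    right
    rcases ih fun i hi => hf i (Finset.mem_insert_of_mem hi) with ⟨h0, h1⟩ | ⟨h0, h1⟩
    · rw [h0, h1]; omega
    · constructor <;> nlinarith

/-- The number of families of characters supported in weight at most `m`. -/
theorem exists_finset_characters {ι : Type} [Fintype ι] (V : ι → Type) [∀ i, Group (V i)]
    [∀ i, Finite (V i)] (K : Type) [Field K] (e : ι → ℕ) (m : ℕ)
    (hV : ∀ i, Nat.card (V i) - 1 ≤ 2 ^ e i) :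
    ∃ Y : Finset (∀ i, V i →* K), Y.card ≤ 2 ^ Fintype.card ι * 2 ^ m ∧
      ∀ χ : ∀ i, V i →* K, ∀ S : Finset ι, (∀ i, i ∈ S ↔ χ i ≠ 1) → ∑ i ∈ S, e i ≤ m → χ ∈ Y := by
  classical
  have hfin := fun i => (finite_and_card_monoidHom_le (V i) K).1
  let _ := fun i => Fintype.ofFinite (V i →* K)
  -- These are the families with support exactly `S`; erasing the trivial character accounts for the
  -- `- 1` in `hV`.
  let P : Finset ι → Finset (∀ i, V i →* K) := fun S =>
    Fintype.piFinset fun i => if i ∈ S then Finset.univ.erase 1 else {1}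
  let I : Finset (Finset ι) := Finset.univ.filter fun S => ∑ i ∈ S, e i ≤ m
  refine ⟨I.biUnion P, ?_, fun χ S hS hm => Finset.mem_biUnion.2 ⟨S, by simpa [I] using hm, ?_⟩⟩
  · refine (Finset.card_biUnion_le_card_mul I P (2 ^ m) fun S hS => ?_).trans ?_
    · have hS : ∑ i ∈ S, e i ≤ m := by simpa [I] using hS
      rw [Fintype.card_piFinset]
      calc ∏ i, (if i ∈ S then Finset.univ.erase 1 else {1} : Finset (V i →* K)).card
          ≤ ∏ i, (if i ∈ S then 2 ^ e i else 1) := by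
            refine Finset.prod_le_prod' fun i _ => ?_
            split_ifs
            · rw [Finset.card_erase_of_mem (Finset.mem_univ _), Finset.card_univ,
                ← Nat.card_eq_fintype_card]
              exact (Nat.sub_le_sub_right (finite_and_card_monoidHom_le (V i) K).2 1).trans (hV i)
            · simp
        _ = 2 ^ ∑ i ∈ S, e i := by
            rw [Finset.prod_ite_mem, Finset.univ_inter, Finset.prod_pow_eq_pow_sum]
        _ ≤ 2 ^ m := Nat.pow_le_pow_right two_pos hS
    · refine Nat.mul_le_mul_right _ ((Finset.card_le_univ I).trans_eq ?_)
      rw [Fintype.card_finset]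
  · rw [Fintype.mem_piFinset]
    intro i
    split_ifs with hi
    · simpa using (hS i).1 hi
    · simpa using not_not.1 (mt (hS i).2 hi)

open Polynomial in
/-- The number of roots in `K` of monic polynomials of degree `m` over `F`. -/
theorem exists_finset_roots (F K : Type) [Field F] [Finite F] [Field K] [Algebra F K] (m : ℕ) :
    ∃ Z : Finset K, Z.card ≤ Nat.card F ^ m * m ∧
      ∀ (x : K) (f : F[X]), f.Monic → f.natDegree = m → aeval x f = 0 → x ∈ Z := by
  classical
  let _ := Fintype.ofFinite F
  let P : (Fin m → F) → F[X] := fun c => X ^ m + ∑ i : Fin m, C (c i) * X ^ (i : ℕ)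
  have hdeg : ∀ c : Fin m → F, (∑ i : Fin m, C (c i) * X ^ (i : ℕ)).degree < (m : WithBot ℕ) :=
    fun c => degree_sum_fin_lt c
  have hP : ∀ c, (P c).Monic ∧ (P c).natDegree = m := fun c =>
    ⟨monic_X_pow_add (hdeg c),
      natDegree_eq_of_degree_eq_some
        ((degree_add_eq_left_of_degree_lt (by rw [degree_X_pow]; exact hdeg c)).trans
          (degree_X_pow m))⟩
  refine ⟨Finset.univ.biUnion fun c => ((P c).aroots K).toFinset, ?_, fun x f hf hm hx => ?_⟩
  · refine (Finset.card_biUnion_le_card_mul _ _ m fun c _ => ?_).trans ?_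
    · refine (Multiset.toFinset_card_le _).trans ((card_roots' _).trans ?_)
      rw [natDegree_map, (hP c).2]
    · rw [Finset.card_univ, Fintype.card_fun, Fintype.card_fin, Nat.card_eq_fintype_card]
  · refine Finset.mem_biUnion.2 ⟨fun i => f.coeff i, Finset.mem_univ _, ?_⟩
    have hfP : P (fun i => f.coeff i) = f := by
      conv_rhs => rw [hf.as_sum, hm]
      simp only [P]
      rw [Fin.sum_univ_eq_sum_range (fun i => C (f.coeff i) * X ^ i)]
    rw [hfP, Multiset.mem_toFinset, mem_aroots]
    exact ⟨hf.ne_zero, hx⟩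

theorem aeval_charpoly_eq_zero_of_extendEnd {F K : Type} [Field F] [Field K] [Algebra F K] {m : ℕ}
    (T : Module.End F (Fin m → F)) {lam : K} {v : Fin m → K} (hv : v ≠ 0)
    (h : extendEnd K m T v = lam • v) : Polynomial.aeval lam T.charpoly = 0 := by
  have h1 : Polynomial.aeval (extendEnd K m T) T.charpoly = 0 := by
    rw [Polynomial.aeval_algHom_apply, LinearMap.aeval_self_charpoly, map_zero]
  have h2 : Polynomial.aeval (extendEnd K m T) (T.charpoly.map (algebraMap F K)) = 0 := by
    rw [Polynomial.aeval_map_algebraMap, h1]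
  have h3 := Module.End.aeval_apply_of_hasEigenvector
    (p := T.charpoly.map (algebraMap F K)) (f := extendEnd K m T) (μ := lam) (x := v)
    ⟨Module.End.mem_eigenspace_iff.2 h, hv⟩
  rw [h2, LinearMap.zero_apply, Polynomial.eval_map_algebraMap] at h3
  exact (smul_eq_zero.1 h3.symm).resolve_right hv

/-- Extension of scalars for representations on coordinate spaces. -/
noncomputable def extendRep {F : Type} [Field F] (K : Type) [Field K] [Algebra F K] {m : ℕ}
    {G : Type} [Group G] (ρ : Representation F G (Fin m → F)) : G →* Module.End K (Fin m → K) :=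
  (extendEnd (F := F) K m).toRingHom.toMonoidHom.comp ρ

/-! ### Bounding supports and counting representations -/

section Bound

variable {p n : ℕ → ℕ}

/-- The least admissible prime is at least `7`, and successive ones differ by at least `4`. Hence
`(p i - 1) / 2` exceeds `i`, which confines supports to indices below the dimension. -/
theorem four_mul_add_seven_le (hp3 : ∀ i, 3 < p i) (hmono : StrictMono p)
    (hmod : ∀ i, p i % 4 = 3) (i : ℕ) : 4 * i + 7 ≤ p i := by
  induction i with
  | zero => have := hp3 0; have := hmod 0; omega
  | succ i ih =>
    have := hmono (Nat.lt_succ_self i)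
    have := hmod i
    have := hmod (i + 1)
    simp only [Nat.succ_eq_add_one] at *
    omega

theorem IsWeightVector.sum_le (hp : ∀ i, (p i).Prime) (hp3 : ∀ i, 3 < p i)
    (hmod : ∀ i, p i % 4 = 3) {K W : Type} [Field K] [AddCommGroup W] [Module K W]
    [FiniteDimensional K W] {γ : ∀ i, oddAut (p i)}
    {ρ : (∀ i, GStar (p i) (n i)) →* Module.End K W} {χ : (∀ i, Fin (n i) → Cyc (p i)) →* K}
    {lam : K} {v : W} (h : IsWeightVector γ ρ χ lam v) (S : Finset ℕ)
    (hS : ∀ i, i ∈ S ↔ InSupp χ i) : ∑ i ∈ S, (p i - 1) / 2 ≤ Module.finrank K W :=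
  (S.sum_le_prod_of_two_le _ fun i _ => by have := hp3 i; have := hmod i; omega).trans
    (h.prod_le hp hmod S hS)

theorem exists_finset_supp {K : Type} [Field K] {χ : (∀ i, Fin (n i) → Cyc (p i)) →* K} {k : ℕ}
    (hχ : TailTrivial k χ) : ∃ S : Finset ℕ, ∀ i, i ∈ S ↔ InSupp χ i := by
  classical
  refine ⟨(Finset.range k).filter (InSupp χ), fun i => ?_⟩
  rw [Finset.mem_filter, Finset.mem_range]
  exact ⟨And.right, fun hi => ⟨hi.lt hχ, hi⟩⟩

/-- The components of a character indexed below `m`. -/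
def restrictCharacter {K : Type} [Field K] (m : ℕ) (χ : (∀ i, Fin (n i) → Cyc (p i)) →* K) :
    ∀ i : Fin m, (Fin (n i) → Cyc (p i)) →* K :=
  fun i => χ.comp (MonoidHom.mulSingle (fun i => Fin (n i) → Cyc (p i)) i)

end Bound

/-- Isomorphism classes inject into pairs of a character and an eigenvalue. The constant `4` has one
unit each for supports, characters on a support, characteristic polynomials and their roots. -/
theorem uberg_pi_gstar (p n : ℕ → ℕ)
    (hp : ∀ i, (p i).Prime) (hp3 : ∀ i, 3 < p i) (hmono : StrictMono p)
    (hmod : ∀ i, p i % 4 = 3)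
    (hcop : Pairwise fun i j => Nat.Coprime ((p i - 1) / 2) ((p j - 1) / 2))
    (hbound : ∀ i, p i ^ n i - 1 ≤ 2 ^ ((p i - 1) / 2)) :
    UBERG (∀ i, GStar (p i) (n i)) := by
  refine ⟨4, by norm_num, fun F _ _ m => ?_⟩
  let K := AlgebraicClosure F
  have hgen := fun i => (oddAut_card_and_generator (hp i) (hmod i)).2.exists_generator
  choose γ hγ using hgen
  have hdata : ∀ ρ : IrrRep (∀ i, GStar (p i) (n i)) F m, ∃ k χ lam v,
      TailTrivial k (extendRep K ρ.1) ∧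
      IsWeightVector γ (extendRep K ρ.1) χ lam v := by
    intro ρ
    obtain ⟨k, hk⟩ := exists_tailTrivial ρ.1 ρ.2.1
    have hk' : TailTrivial k (extendRep K ρ.1) := fun x hx => by
      rw [extendRep, MonoidHom.comp_apply, hk x hx, map_one]
    have : Nontrivial (Fin m → K) := by
      have := ρ.2.2
      have hs := IsSimpleModule.nontrivial
        (MonoidAlgebra F (∀ i, GStar (p i) (n i))) ρ.1.asModule
      have hs : Nontrivial (Fin m → F) := hs
      rcases Nat.eq_zero_or_pos m with rfl | hm
      · exact absurd hs (not_nontrivial _)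
      · have : Nonempty (Fin m) := ⟨⟨0, hm⟩⟩
        infer_instance
    obtain ⟨χ, lam, v, h⟩ := exists_isWeightVector hk' γ
    exact ⟨k, χ, lam, v, hk', h⟩
  choose k χ lam v hk hw using hdata
  have hχ : ∀ ρ, TailTrivial (k ρ) (χ ρ) := fun ρ =>
    tailTrivial_of_weight (hk ρ) (hw ρ).ne_zero (hw ρ).inlPi_apply
  have hsum : ∀ ρ S, (∀ i, i ∈ S ↔ InSupp (χ ρ) i) → ∑ i ∈ S, (p i - 1) / 2 ≤ m := by
    intro ρ S hS
    simpa using (hw ρ).sum_le hp hp3 hmod S hS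
  have hlt : ∀ ρ i, InSupp (χ ρ) i → i < m := by
    intro ρ i hi
    obtain ⟨S, hS⟩ := exists_finset_supp (hχ ρ)
    have h1 := hsum ρ S hS
    have h2 := Finset.single_le_sum (f := fun i => (p i - 1) / 2) (fun _ _ => Nat.zero_le _)
      ((hS i).2 hi)
    have := four_mul_add_seven_le hp3 hmono hmod i
    have h2 : (p i - 1) / 2 ≤ ∑ i ∈ S, (p i - 1) / 2 := h2
    omega
  let d : IrrRep (∀ i, GStar (p i) (n i)) F m → (∀ i : Fin m, (Fin (n i) → Cyc (p i)) →* K) × K :=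
    fun ρ => (restrictCharacter m (χ ρ), lam ρ)
  have hd : ∀ ρ σ, d ρ = d σ → Nonempty (ρ.1.Equiv σ.1) := by
    intro ρ σ h
    have h1 : χ ρ = χ σ := by
      refine MonoidHom.pi_ext_of_tail (max (k ρ) (k σ)) (fun x hx => ?_) fun i x => ?_
      · rw [(hχ ρ).mono (le_max_left _ _) x hx, (hχ σ).mono (le_max_right _ _) x hx]
      · by_cases hi : i < m
        · exact congrArg (fun f => f.1 ⟨i, hi⟩ x) h
        · rw [apply_mulSingle_of_not_inSupp (mt (hlt ρ i) hi),
            apply_mulSingle_of_not_inSupp (mt (hlt σ i) hi)]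
    have h2 : lam ρ = lam σ := congrArg Prod.snd h
    have := ρ.2.2
    have := σ.2.2
    -- Both representations must use the same exponent, as it enters the common coefficient; hence
    -- the maximum of the two tails.
    have hl : ∀ g : ∀ i, GStar (p i) (n i), ∃ l : ℕ, ∀ i < max (k ρ) (k σ),
        GStar.right (g i) = γ i ^ l :=
      fun g => exists_pow_eq hp hmod hcop hγ _ _
    choose l hl using hl
    have hσ := hw σ
    rw [← h1, ← h2] at hσ
    exact Representation.nonempty_equiv_of_monomial ρ.1 σ.1
      (fun g => χ ρ (actPi n (extendOne (χ ρ) fun i => GStar.right (g i))⁻¹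
        fun i => (g i).left) * lam ρ ^ l g) (fun g (i : {i // InSupp (χ ρ) i}) => GStar.right (g i))
      (w := fun τ => extendRep K ρ.1 (inrPi (extendOne (χ ρ) τ)) (v ρ))
      (w' := fun τ => extendRep K σ.1 (inrPi (extendOne (χ ρ) τ)) (v σ)) (hw ρ).ne_zero hσ.ne_zero
      ((hw ρ).linearIndependent hp)
      (fun g => (hw ρ).apply_eq ((hk ρ).mono (le_max_left _ _)) g (l g) (hl g))
      (fun g => hσ.apply_eq ((hk σ).mono (le_max_right _ _)) g (l g) (hl g))
  have hcyc : ∀ i, Nat.card (Fin (n i) → Cyc (p i)) = p i ^ n i := fun i => by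
    rw [Nat.card_fun, Nat.card_fin]
    exact congrArg (· ^ n i) (Nat.card_zmod (p i))
  have hfin : ∀ i, Finite (Fin (n i) → Cyc (p i)) := fun i => Nat.finite_of_card_ne_zero (by
    rw [hcyc]
    exact pow_ne_zero _ (hp i).ne_zero)
  obtain ⟨Y, hYc, hY⟩ := exists_finset_characters (fun i : Fin m => Fin (n i) → Cyc (p i)) K
    (fun i => (p i - 1) / 2) m fun i => by rw [hcyc]; exact hbound i
  obtain ⟨Z, hZc, hZ⟩ := exists_finset_roots F K m
  have hmem : ∀ ρ, d ρ ∈ Y ×ˢ Z := by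
    classical
    intro ρ
    refine Finset.mem_product.2 ⟨?_, ?_⟩
    · obtain ⟨S, hS⟩ := exists_finset_supp (hχ ρ)
      refine hY _ (Finset.univ.filter fun i : Fin m => (i : ℕ) ∈ S) (fun i => ?_) ?_
      · rw [Finset.mem_filter, hS]
        exact ⟨And.right, fun h => ⟨Finset.mem_univ _, h⟩⟩
      · refine le_trans (le_of_eq ?_) (hsum ρ S hS)
        refine Finset.sum_bij (fun i _ => (i : ℕ)) (fun i hi => (Finset.mem_filter.1 hi).2)
          (fun i _ j _ hij => Fin.ext hij) (fun i hi => ?_) fun i _ => rfl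
        exact ⟨⟨i, hlt ρ i ((hS i).1 hi)⟩, by simpa using hi, rfl⟩
    -- The eigenvalue lies in `K`, but the operator comes from a group element and so is defined
    -- over `F`.
    · refine hZ _ (ρ.1 (inrPi (offSupp (χ ρ) γ))).charpoly (LinearMap.charpoly_monic _) ?_
        (aeval_charpoly_eq_zero_of_extendEnd _ (hw ρ).ne_zero (hw ρ).inrPi_apply)
      rw [LinearMap.charpoly_natDegree, Module.finrank_fin_fun]
  let q : Quotient (IrrRep.setoid (∀ i, GStar (p i) (n i)) F m) → (Y ×ˢ Z : Finset _) :=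
    fun x => ⟨d x.out, hmem x.out⟩
  have hq : Function.Injective q := by
    intro x y hxy
    rw [← Quotient.out_eq x, ← Quotient.out_eq y]
    exact Quotient.sound (hd _ _ (congrArg Subtype.val hxy))
  refine ⟨Finite.of_injective q hq, ?_⟩
  have hF : 2 ≤ Nat.card F := Finite.one_lt_card
  have hcard : Nat.card (Quotient (IrrRep.setoid (∀ i, GStar (p i) (n i)) F m)) ≤
      Nat.card F ^ (4 * m) := by
    refine (Nat.card_le_card_of_injective q hq).trans ?_
    rw [Nat.card_eq_fintype_card, Fintype.card_coe, Finset.card_product]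
    rw [Fintype.card_fin] at hYc
    have h2 : 2 ^ m ≤ Nat.card F ^ m := Nat.pow_le_pow_left hF m
    calc Y.card * Z.card ≤ (2 ^ m * 2 ^ m) * (Nat.card F ^ m * m) := Nat.mul_le_mul hYc hZc
      _ ≤ (Nat.card F ^ m * Nat.card F ^ m) * (Nat.card F ^ m * Nat.card F ^ m) :=
        Nat.mul_le_mul (Nat.mul_le_mul h2 h2)
          -- The factor `m` is absorbed through `m < 2 ^ m`.
          (Nat.mul_le_mul_left _ ((Nat.lt_two_pow_self).le.trans h2))
      _ = Nat.card F ^ (4 * m) := by ring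
  calc (Nat.card (Quotient (IrrRep.setoid (∀ i, GStar (p i) (n i)) F m)) : ℝ)
      ≤ ((Nat.card F ^ (4 * m) : ℕ) : ℝ) := by exact_mod_cast hcard
    _ = (Nat.card F : ℝ) ^ ((4 : ℝ) * m) := by
      rw [Nat.cast_pow, ← Real.rpow_natCast]
      push_cast
      rfl

theorem mainTheorem10 (p n : ℕ → ℕ)
    (hp : ∀ i, (p i).Prime) (hp3 : ∀ i, 3 < p i) (hmono : StrictMono p)
    (hmod : ∀ i, p i % 4 = 3)
    (hcop : Pairwise fun i j => Nat.Coprime ((p i - 1) / 2) ((p j - 1) / 2))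
    (hn : Filter.Tendsto n Filter.atTop Filter.atTop)
    (hbound : ∀ i, p i ^ n i - 1 ≤ 2 ^ ((p i - 1) / 2)) :
    derivedSeries (∀ i, GStar (p i) (n i)) 2 = ⊥ ∧
    UBERG (∀ i, GStar (p i) (n i)) ∧
    ¬ TopFG (∀ i, GStar (p i) (n i)) ∧
    ¬ GroupTypeFP (∀ i, GStar (p i) (n i)) 1 ∧
    ¬ GroupTypePFP (∀ i, GStar (p i) (n i)) 1 :=
  ⟨derivedSeries_pi_gstar p n, uberg_pi_gstar p n hp hp3 hmono hmod hcop hbound,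
    not_topFG_pi_gstar p n hp hn, not_groupTypeFP_pi_gstar p n hp hn,
    fun h => not_groupTypeFP_pi_gstar p n hp hn h.groupTypeFP⟩
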